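/- Let $\Gamma=\langle a,b\mid ab^{-1}a^{-1}b^{2}a^{-1}b^{-1}ab^{3}\rangle$ be the fundamental group of the one-cusped hyperbolic manifold m023 of the SnapPy census, with peripheral subgroup generated by the two peripheral curves $m=bab$ and $l=b^2ab^{-1}a^{-1}b^{-1}ab^2$. The fundamental group of the Dehn filling $\mathrm{m023}(2,-1)$ is $\Gamma/\langle\!\langle m^{2}l^{-1}\rangle\!\rangle$. Let $$\Lambda(3,3,4)=\langle a,b,c\mid a^2=b^2=c^2=(ab)^3=(bc)^3=(ca)^4=e\rangle,\qquad \Lambda_2(3,3,4)=\langle x,y\mid x^3=y^3=(xy)^4=e\rangle,$$ with the morphism $\iota:\Lambda_2(3,3,4)\to\Lambda(3,3,4)$, $x\mapsto ab$, $y\mapsto bc$, and $[x,y]=xyx^{-1}y^{-1}$. An element of $\mathrm{PU}(2,1)$ is called unipotent if it is not the identity and has a lift to $\mathrm{U}(2,1)$ all of whose eigenvalues are $1$. Its trace is the trace of a lift to $\mathrm{SU}(2,1)$, defined up to a cube root of unity; it is said to be real if some lift to $\mathrm{SU}(2,1)$ has real trace. A complex hyperbolic triangle group $\Delta(3,3,4;\theta)$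 is a representation of $\Lambda(3,3,4)$ in $\mathrm{PU}(2,1)$ sending $a,b,c$ to complex reflections $I_1,I_2,I_3$ of order two in complex lines of $\mathbf H^2_{\mathbf C}$ polar to positive vectors $v_1,v_2,v_3$, with angular invariant $\theta=-\arg(\langle v_1,v_2\rangle\langle v_2,v_3\rangle\langle v_3,v_1\rangle)$; its composition with $\iota$ (that is, $x\mapsto I_1I_2$, $y\mapsto I_2I_3$) is the corresponding representation $\Lambda_2(3,3,4)\to\Delta_2(3,3,4;\theta)$. Proposition. There is a surjective morphism $\rho:\Gamma\to\Lambda_2(3,3,4)$ such that: 1. $\rho$ factors through the fundamental group of $\mathrm{m023}(2,-1)$. More precisely, the latter is isomorphic to $\langle a,b\mid a^4b^3=ab^{-1}ab^2ab^2=e\rangle$ by an isomorphism sending $(m,l)$, up to a simultaneous conjugation, to $(ab^{-1}a^{-1}b,\,(ab^{-1}a^{-1}b)^2)$, and in these generators $\rho$ is induced by $a\mapsto xy$, $b\mapsto x$. 2. There exist representations $\eta:\Lambda_2(3,3,4)\to\mathrm{PU}(2,1)$ with $\eta([x,y])$ unipotent. For every such $\eta$: - $\eta\circ\rho$ has boundary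 unipotent holonomy: the peripheral subgroup of $\Gamma$ is sent to an abelian subgroup of $\mathrm{PU}(2,1)$ generated by one or two unipotent elements; - $\operatorname{tr}\eta(xy^{-1})$ is not real; - $\eta\circ\rho$ is not of the form $\Gamma\xrightarrow{\rho}\Lambda_2(3,3,4)\to\Delta_2(3,3,4;\theta)\subset\mathrm{PU}(2,1)$ for any complex hyperbolic triangle group $\Delta(3,3,4;\theta)$; - $\eta$ is a Lagrangian triangle group: there are antiholomorphic reflections $\sigma_1,\sigma_2,\sigma_3$ of $\mathbf H^2_{\mathbf C}$ (each fixing a Lagrangian plane pointwise) with $\eta(x)=\sigma_1\sigma_2$ and $\eta(y)=\sigma_2\sigma_3$. 3. For every complex hyperbolic triangle group $\Delta(3,3,4;\theta)$, the corresponding representation $\Lambda_2(3,3,4)\to\Delta_2(3,3,4;\theta)$ sends $xy^{-1}$ to an element with real trace. -/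

import Mathlib

noncomputable section

namespace CRTriangle

/-! ### Abstract triangle groups -/

/-- The relators `a², b², c², (ab)^p, (bc)^q, (ca)^r`. -/
def triangleRels (p q r : ℕ) : Set (FreeGroup (Fin 3)) :=
  {FreeGroup.of 0 ^ 2, FreeGroup.of 1 ^ 2, FreeGroup.of 2 ^ 2,
    (FreeGroup.of 0 * FreeGroup.of 1) ^ p, (FreeGroup.of 1 * FreeGroup.of 2) ^ q,
    (FreeGroup.of 2 * FreeGroup.of 0) ^ r}

/-- The abstract triangle group `Λ(p,q,r) = ⟨a,b,c | a²=b²=c²=(ab)^p=(bc)^q=(ca)^r=1⟩`;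
the generators `a, b, c` are `PresentedGroup.of 0, 1, 2`. -/
abbrev TriangleGroup (p q r : ℕ) : Type := PresentedGroup (triangleRels p q r)

/-- The relators `x^p, y^q, (xy)^r`. -/
def triangleRels₂ (p q r : ℕ) : Set (FreeGroup (Fin 2)) :=
  {FreeGroup.of 0 ^ p, FreeGroup.of 1 ^ q, (FreeGroup.of 0 * FreeGroup.of 1) ^ r}

/-- The group `Λ₂(p,q,r) = ⟨x,y | x^p=y^q=(xy)^r=1⟩`. -/
abbrev TriangleGroup₂ (p q r : ℕ) : Type := PresentedGroup (triangleRels₂ p q r)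

/-- The generator `x` of `Λ₂(p,q,r)`. -/
def genX (p q r : ℕ) : TriangleGroup₂ p q r := PresentedGroup.of 0

/-- The generator `y` of `Λ₂(p,q,r)`. -/
def genY (p q r : ℕ) : TriangleGroup₂ p q r := PresentedGroup.of 1

/-- The commutator `[x,y] = x y x⁻¹ y⁻¹` in `Λ₂(p,q,r)`. -/
def genComm (p q r : ℕ) : TriangleGroup₂ p q r :=
  genX p q r * genY p q r * (genX p q r)⁻¹ * (genY p q r)⁻¹

theorem triangle_rel {p q r : ℕ} {w : FreeGroup (Fin 3)} (h : w ∈ triangleRels p q r) :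
    (PresentedGroup.mk (triangleRels p q r) w) = 1 :=
  PresentedGroup.one_of_mem h

/-- The images `ab`, `bc` of `x`, `y`. -/
def inclFun (p q r : ℕ) : Fin 2 → TriangleGroup p q r :=
  ![PresentedGroup.of 0 * PresentedGroup.of 1, PresentedGroup.of 1 * PresentedGroup.of 2]

theorem inclFun_rels (p q r : ℕ) :
    ∀ w ∈ triangleRels₂ p q r, FreeGroup.lift (inclFun p q r) w = 1 := by
  have h2 : (PresentedGroup.of 1 : TriangleGroup p q r) ^ 2 = 1 :=
    triangle_rel (w := FreeGroup.of 1 ^ 2) (by simp [triangleRels])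
  have h1 : (PresentedGroup.of 0 : TriangleGroup p q r) ^ 2 = 1 :=
    triangle_rel (w := FreeGroup.of 0 ^ 2) (by simp [triangleRels])
  have h3 : (PresentedGroup.of 2 : TriangleGroup p q r) ^ 2 = 1 :=
    triangle_rel (w := FreeGroup.of 2 ^ 2) (by simp [triangleRels])
  have hp : ((PresentedGroup.of 0 : TriangleGroup p q r) * PresentedGroup.of 1) ^ p = 1 :=
    triangle_rel (w := (FreeGroup.of 0 * FreeGroup.of 1) ^ p) (by simp [triangleRels])
  have hq : ((PresentedGroup.of 1 : TriangleGroup p q r) * PresentedGroup.of 2) ^ q = 1 :=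
    triangle_rel (w := (FreeGroup.of 1 * FreeGroup.of 2) ^ q) (by simp [triangleRels])
  have hr : ((PresentedGroup.of 2 : TriangleGroup p q r) * PresentedGroup.of 0) ^ r = 1 :=
    triangle_rel (w := (FreeGroup.of 2 * FreeGroup.of 0) ^ r) (by simp [triangleRels])
  intro w hw
  simp only [triangleRels₂, Set.mem_insert_iff, Set.mem_singleton_iff] at hw
  rcases hw with rfl | rfl | rfl
  · simpa [inclFun] using hp
  · simpa [inclFun] using hq
  · have e : (PresentedGroup.of 0 : TriangleGroup p q r) * PresentedGroup.of 1 *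
        (PresentedGroup.of 1 * PresentedGroup.of 2) =
        ((PresentedGroup.of 2 : TriangleGroup p q r) * PresentedGroup.of 0)⁻¹ := by
      rw [mul_inv_rev, inv_eq_of_mul_eq_one_left (a := PresentedGroup.of 0)
        (b := (PresentedGroup.of 0 : TriangleGroup p q r)) (by rw [← sq, h1]),
        inv_eq_of_mul_eq_one_left (a := PresentedGroup.of 2)
        (b := (PresentedGroup.of 2 : TriangleGroup p q r)) (by rw [← sq, h3]),
        mul_assoc, ← mul_assoc (PresentedGroup.of 1), ← sq, h2, one_mul]
    have : FreeGroup.lift (inclFun p q r) ((FreeGroup.of 0 * FreeGroup.of 1) ^ r) =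
        (((PresentedGroup.of 2 : TriangleGroup p q r) * PresentedGroup.of 0)⁻¹) ^ r := by
      rw [← e]; simp [inclFun]
    rw [this, inv_pow, hr, inv_one]

/-- The morphism `Λ₂(p,q,r) → Λ(p,q,r)`, `x ↦ ab`, `y ↦ bc`. -/
def incl (p q r : ℕ) : TriangleGroup₂ p q r →* TriangleGroup p q r :=
  PresentedGroup.toGroup (inclFun_rels p q r)

/-! ### The fundamental group of m023 and its Dehn fillings -/

/-- The relator `a b⁻¹ a⁻¹ b² a⁻¹ b⁻¹ a b³`. -/
def m023Rels : Set (FreeGroup (Fin 2)) :=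
  let a := FreeGroup.of (0 : Fin 2)
  let b := FreeGroup.of (1 : Fin 2)
  {a * b⁻¹ * a⁻¹ * b ^ 2 * a⁻¹ * b⁻¹ * a * b ^ 3}

/-- `π₁(m023) = ⟨a,b | a b⁻¹ a⁻¹ b² a⁻¹ b⁻¹ a b³⟩`. -/
abbrev M023 : Type := PresentedGroup m023Rels

/-- The first peripheral curve, `bab`. -/
def meridian : M023 :=
  let a : M023 := PresentedGroup.of 0
  let b : M023 := PresentedGroup.of 1
  b * a * b

/-- The second peripheral curve, `b² a b⁻¹ a⁻¹ b⁻¹ a b²`. -/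
def longitude : M023 :=
  let a : M023 := PresentedGroup.of 0
  let b : M023 := PresentedGroup.of 1
  b ^ 2 * a * b⁻¹ * a⁻¹ * b⁻¹ * a * b ^ 2

/-- The peripheral subgroup of the unique cusp of m023. -/
def peripheral : Subgroup M023 := Subgroup.closure {meridian, longitude}

/-- The fundamental group of the Dehn filling `m023(m,l)`: the slope
`meridian^m * longitude^l` is killed. -/
abbrev M023Filling (m l : ℤ) : Type :=
  M023 ⧸ Subgroup.normalClosure {meridian ^ m * longitude ^ l}

/-- The relators `a⁴b³` and `a b⁻¹ a b² a b²`. -/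
def fillingRels : Set (FreeGroup (Fin 2)) :=
  let a := FreeGroup.of (0 : Fin 2)
  let b := FreeGroup.of (1 : Fin 2)
  {a ^ 4 * b ^ 3, a * b⁻¹ * a * b ^ 2 * a * b ^ 2}

/-- The group `⟨a,b | a⁴b³ = a b⁻¹ a b² a b² = 1⟩`. -/
abbrev FillingPresentation : Type := PresentedGroup fillingRels

/-- The word `a b⁻¹ a⁻¹ b` in the presentation of the filling. -/
def fillingCurve : FillingPresentation :=
  let a : FillingPresentation := PresentedGroup.of 0
  let b : FillingPresentation := PresentedGroup.of 1
  a * b⁻¹ * a⁻¹ * b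

/-! ### The group `PU(2,1)` -/

/-- The Hermitian product `z₁w̄₁ + z₂w̄₂ - z₃w̄₃` on `ℂ³`. -/
def herm (z w : Fin 3 → ℂ) : ℂ :=
  z 0 * star (w 0) + z 1 * star (w 1) - z 2 * star (w 2)

/-- The unitary group `U(2,1)`. -/
def U21 : Subgroup (GL (Fin 3) ℂ) where
  carrier := {A | ∀ z w, herm (A.1.mulVec z) (A.1.mulVec w) = herm z w}
  one_mem' := by intro z w; simp
  mul_mem' := by
    intro A B hA hB z w
    simp only [Units.val_mul, ← Matrix.mulVec_mulVec]
    rw [hA, hB]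
  inv_mem' := by
    intro A hA z w
    have h : ∀ v, A.1.mulVec ((A⁻¹).1.mulVec v) = v := by
      intro v
      rw [Matrix.mulVec_mulVec, ← Units.val_mul, mul_inv_cancel, Units.val_one, Matrix.one_mulVec]
    have := hA ((A⁻¹).1.mulVec z) ((A⁻¹).1.mulVec w)
    rw [h, h] at this
    exact this.symm

/-- The underlying matrix of an element of `U(2,1)`. -/
def U21.mat (A : U21) : Matrix (Fin 3) (Fin 3) ℂ := A.1.1

/-- The scalar matrices in `U(2,1)`. -/
def scalars : Subgroup U21 where
  carrier := {A | ∃ c : ℂ, U21.mat A = c • (1 : Matrix (Fin 3) (Fin 3) ℂ)}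
  one_mem' := ⟨1, by simp [U21.mat]⟩
  mul_mem' := by
    rintro A B ⟨c, hc⟩ ⟨d, hd⟩
    refine ⟨c * d, ?_⟩
    have : U21.mat (A * B) = U21.mat A * U21.mat B := rfl
    rw [this, hc, hd]
    simp [smul_smul, mul_comm]
  inv_mem' := by
    rintro A ⟨c, hc⟩
    have h : U21.mat A * U21.mat A⁻¹ = 1 := by
      change A.1.1 * (A.1⁻¹).1 = 1
      rw [← Units.val_mul, mul_inv_cancel, Units.val_one]
    rw [hc, smul_mul_assoc, one_mul] at h
    have hc0 : c ≠ 0 := by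
      rintro rfl
      have := congrFun (congrFun h 0) 0
      simp at this
    exact ⟨c⁻¹, by rw [← h, smul_smul, inv_mul_cancel₀ hc0, one_smul]⟩

instance : scalars.Normal where
  conj_mem := by
    rintro A ⟨c, hc⟩ g
    refine ⟨c, ?_⟩
    have h : U21.mat (g * A * g⁻¹) = U21.mat g * U21.mat A * U21.mat g⁻¹ := rfl
    have h' : U21.mat g * U21.mat g⁻¹ = 1 := by
      change g.1.1 * (g.1⁻¹).1 = 1
      rw [← Units.val_mul, mul_inv_cancel, Units.val_one]
    rw [h, hc, mul_smul_comm, mul_one, smul_mul_assoc, h']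

/-- The projective unitary group `PU(2,1)`. -/
abbrev PU21 : Type := U21 ⧸ scalars

/-- The class in `PU(2,1)` of an element of `U(2,1)`. -/
def proj : U21 →* PU21 := QuotientGroup.mk' scalars

/-- Unipotent elements of `PU(2,1)`: non-trivial elements with a lift all of whose eigenvalues
are `1` (the identity is excluded: unipotent elements are parabolic). -/
def IsUnipotent (g : PU21) : Prop :=
  g ≠ 1 ∧ ∃ A : U21, proj A = g ∧ IsNilpotent (U21.mat A - 1)

/-- The trace of an element of `PU(2,1)` is that of a lift to `SU(2,1)`, defined up to a cube root
of unity; it is real if some lift to `SU(2,1)` has real trace. -/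
def HasRealTrace (g : PU21) : Prop :=
  ∃ A : U21, proj A = g ∧ (U21.mat A).det = 1 ∧ (U21.mat A).trace.im = 0

/-- `g` is the complex reflection of order two in the complex line of the complex hyperbolic plane
polar to the positive vector `v`, that is, the class of `z ↦ -z + 2 (⟨z,v⟩ / ⟨v,v⟩) v`. -/
def IsComplexReflection (v : Fin 3 → ℂ) (g : PU21) : Prop :=
  0 < (herm v v).re ∧
    ∃ A : U21, proj A = g ∧ ∀ z, (U21.mat A).mulVec z = -z + (2 * herm z v / herm v v) • v

/-- `γ` is a complex hyperbolic triangle group `Δ(p,q,r;θ)`: a representation of `Λ(p,q,r)` in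
`PU(2,1)` by complex reflections `I₁, I₂, I₃` in complex lines polar to `v₁, v₂, v₃`, with angular
invariant `θ = -arg(⟨v₁,v₂⟩⟨v₂,v₃⟩⟨v₃,v₁⟩)` modulo `2π`. The restriction of `γ` to `Λ₂(p,q,r)`,
i.e. `x ↦ I₁I₂`, `y ↦ I₂I₃`, is `γ.comp (incl p q r)`, with image `Δ₂(p,q,r;θ)`. -/
def IsComplexTriangle {p q r : ℕ} (θ : ℝ) (γ : TriangleGroup p q r →* PU21) : Prop :=
  ∃ v : Fin 3 → (Fin 3 → ℂ),
    (∀ i, IsComplexReflection (v i) (γ (PresentedGroup.of i))) ∧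
    (θ : Real.Angle) =
      -(Complex.arg (herm (v 0) (v 1) * herm (v 1) (v 2) * herm (v 2) (v 0)) : Real.Angle)

/-! ### Antiholomorphic reflections -/

/-- An antilinear involution of `ℂ³` compatible with the Hermitian product. On the complex
hyperbolic plane it induces the antiholomorphic reflection that fixes the real (Lagrangian) plane
of the negative lines spanned by vectors `v` with `σ v = v`; every antiholomorphic reflection is
induced by such a map. -/
def IsAntiReflection (σ : (Fin 3 → ℂ) →ₗ⋆[ℂ] (Fin 3 → ℂ)) : Prop :=
  (∀ v, σ (σ v) = v) ∧ ∀ v w, herm (σ v) (σ w) = star (herm v w)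

/-- `g` is the composition `σ τ` of the isometries induced by `σ` and `τ`. -/
def IsProduct (σ τ : (Fin 3 → ℂ) →ₗ⋆[ℂ] (Fin 3 → ℂ)) (g : PU21) : Prop :=
  ∃ A : U21, proj A = g ∧ ∀ v, (U21.mat A).mulVec v = σ (τ v)

/-- `η` is a Lagrangian triangle group: there are antiholomorphic reflections `σ₁, σ₂, σ₃` of the
complex hyperbolic plane with `η(x) = σ₁σ₂` and `η(y) = σ₂σ₃`. -/
def IsLagrangianTriangle {p q r : ℕ} (η : TriangleGroup₂ p q r →* PU21) : Prop :=
  ∃ σ₁ σ₂ σ₃ : (Fin 3 → ℂ) →ₗ⋆[ℂ] (Fin 3 → ℂ),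
    IsAntiReflection σ₁ ∧ IsAntiReflection σ₂ ∧ IsAntiReflection σ₃ ∧
    IsProduct σ₁ σ₂ (η (genX p q r)) ∧ IsProduct σ₂ σ₃ (η (genY p q r))

/-- The peripheral subgroup of `π₁(m023)` is sent to an abelian subgroup of `PU(2,1)` generated by
one or two unipotent elements (one if `u = w`). -/
def IsBoundaryUnipotent (ξ : M023 →* PU21) : Prop :=
  ∃ u w : PU21, IsUnipotent u ∧ IsUnipotent w ∧ Commute u w ∧
    peripheral.map ξ = Subgroup.closure {u, w}

end CRTriangle

end

open CRTriangle

/-! Killing m²l⁻¹ adds one relator to Γ, and mutually inverse substitutions identify the quotient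
with ⟨a,b | a⁴b³, ab⁻¹ab²ab²⟩, where the peripheral curves become ab⁻¹a⁻¹b and its square. Under a ↦
xy, b ↦ x they go to [x,y] and [x,y]², so unipotency of η([x,y]) alone gives boundary unipotent
holonomy.

For a complex triangle group, xy⁻¹ goes to I₁I₂I₃I₂, a product of two involutions, hence conjugate
to its inverse. In U(2,1) the trace of an inverse is the conjugate trace, so this trace is real.
Since ρ is surjective, an η with tr η(xy⁻¹) not real cannot come from such a group.

Let X, Y be lifts of η(x), η(y) with cube 1. Their commutator has trace 3c with c³ = 1, and XY is
projectively of order dividing 4 but not scalar, so |tr XY|² is 1 or 5. If X or Y had a repeated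
eigenvalue, |tr XY|² would be 0, 3 or 9 (`CommPair.regular`). Hence X is diag(1, ω, ω²) in an
orthogonal basis; let M, N be the matrices of Y, Y⁻¹ there. The products M_ij N_ji are real with row
sums 1, and tr [X,Y] is T + ω²s + ωs' for three partial sums of them. This forces T = 3, s = s' = 0
(`EigenBasis.entries`), with two consequences: - w = tr XY and z = tr XY⁻¹ satisfy |w|² + |z|² = 9
and 2 Re w³ + 2 Re z³ + |w|²|z|² = 54 (`EigenBasis.trace_identities`). With the possible values of
w³, this prevents z from being real up to a cube root of unity. - The cyclic products M₀₁M₁₂M₂₀ and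
M₁₀M₂₁M₀₂ agree, so a diagonal matrix of phases conjugates the complex conjugate of M to N
(`EigenBasis.exists_phases`). It defines an antiholomorphic reflection σ₂ inverting both X and Y;
then σ₁ = Xσ₂ and σ₃ = σ₂Y.

Existence of η is shown by explicit matrices over ℚ(√−7). -/

namespace CRTriangle

/-! ### Word identities behind the presentation of the filling group -/

section GroupIdentities

variable {G : Type*} [Group G] {a b : G}

/-- This is the m023 relator evaluated at ba², ab. As in the identities below, the certificate is an
equation in the free group writing the word as a product of conjugates of the relators and their
inverses; `simp` checks it by free reduction. -/
theorem filling_relation₁ (h₁ : a ^ 4 * b ^ 3 = 1) (h₂ : a * b⁻¹ * a * b ^ 2 * a * b ^ 2 = 1) :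
    (b * a ^ 2) * (a * b)⁻¹ * (b * a ^ 2)⁻¹ * (a * b) ^ 2 * (b * a ^ 2)⁻¹ * (a * b)⁻¹ *
      (b * a ^ 2) * (a * b) ^ 3 = 1 := by
  have key : (b * a ^ 2) * (a * b)⁻¹ * (b * a ^ 2)⁻¹ * (a * b) ^ 2 * (b * a ^ 2)⁻¹ * (a * b)⁻¹ *
      (b * a ^ 2) * (a * b) ^ 3 =
      ((b * a ^ 2 * b⁻¹ * a⁻¹ ^ 3) * (a ^ 4 * b ^ 3)⁻¹ * (b * a ^ 2 * b⁻¹ * a⁻¹ ^ 3)⁻¹) *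
      ((b * a) * (a * b⁻¹ * a * b ^ 2 * a * b ^ 2) * (b * a)⁻¹) *
      ((b * a) * (a ^ 4 * b ^ 3)⁻¹ * (b * a)⁻¹) *
      ((b * a ^ 4 * b * a⁻¹) * (a * b⁻¹ * a * b ^ 2 * a * b ^ 2) * (b * a ^ 4 * b * a⁻¹)⁻¹) *
      ((b) * (a ^ 4 * b ^ 3) * (b)⁻¹) *
      ((b⁻¹ * a⁻¹ * b⁻¹ * a⁻¹ ^ 2 * b⁻¹ ^ 2 * a⁻¹ * b⁻¹ ^ 2 * a⁻¹ ^ 4) * (a ^ 4 * b ^ 3) * (b⁻¹ * a⁻¹ * b⁻¹ * a⁻¹ ^ 2 * b⁻¹ ^ 2 * a⁻¹ * b⁻¹ ^ 2 * a⁻¹ ^ 4)⁻¹) *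
      ((b⁻¹ * a⁻¹ * b⁻¹ * a⁻¹ ^ 2 * b⁻¹ ^ 2 * a⁻¹) * (a ^ 4 * b ^ 3)⁻¹ * (b⁻¹ * a⁻¹ * b⁻¹ * a⁻¹ ^ 2 * b⁻¹ ^ 2 * a⁻¹)⁻¹) *
      ((b⁻¹ * a⁻¹ * b⁻¹ * a⁻¹ ^ 2 * b⁻¹ ^ 2 * a ^ 3 * b * a⁻¹) * (a * b⁻¹ * a * b ^ 2 * a * b ^ 2)⁻¹ * (b⁻¹ * a⁻¹ * b⁻¹ * a⁻¹ ^ 2 * b⁻¹ ^ 2 * a ^ 3 * b * a⁻¹)⁻¹) *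
      ((b⁻¹ * a⁻¹ * b⁻¹ * a⁻¹ ^ 2 * b⁻¹ ^ 2) * (a ^ 4 * b ^ 3) * (b⁻¹ * a⁻¹ * b⁻¹ * a⁻¹ ^ 2 * b⁻¹ ^ 2)⁻¹) *
      ((b⁻¹ * a⁻¹ * b⁻¹ * a⁻¹ ^ 2 * b⁻¹ ^ 3 * a⁻¹ ^ 3) * (a ^ 4 * b ^ 3) * (b⁻¹ * a⁻¹ * b⁻¹ * a⁻¹ ^ 2 * b⁻¹ ^ 3 * a⁻¹ ^ 3)⁻¹) *
      ((b⁻¹ * a⁻¹ * b⁻¹ * a⁻¹ ^ 2 * b⁻¹ ^ 3 * a⁻¹ ^ 4) * (a ^ 4 * b ^ 3)⁻¹ * (b⁻¹ * a⁻¹ * b⁻¹ * a⁻¹ ^ 2 * b⁻¹ ^ 3 * a⁻¹ ^ 4)⁻¹) := by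
    simp [pow_succ, mul_assoc]
  rw [key, h₁, h₂]
  simp

/-- The word is the Dehn filling slope, up to conjugation, evaluated at ba², ab. -/
theorem filling_relation₂ (h₁ : a ^ 4 * b ^ 3 = 1) (h₂ : a * b⁻¹ * a * b ^ 2 * a * b ^ 2 = 1) :
    (b * a ^ 2) * (a * b) ^ 2 * (b * a ^ 2) * (a * b)⁻¹ * (b * a ^ 2)⁻¹ * (a * b) * (b * a ^ 2) *
      (a * b) * (b * a ^ 2)⁻¹ * (a * b)⁻¹ = 1 := by
  have key : (b * a ^ 2) * (a * b) ^ 2 * (b * a ^ 2) * (a * b)⁻¹ * (b * a ^ 2)⁻¹ * (a * b) *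
      (b * a ^ 2) * (a * b) * (b * a ^ 2)⁻¹ * (a * b)⁻¹ =
      ((b⁻¹ ^ 2 * a⁻¹ ^ 4) * (a ^ 4 * b ^ 3) * (b⁻¹ ^ 2 * a⁻¹ ^ 4)⁻¹) *
      ((a ^ 4 * b ^ 3)⁻¹) *
      ((a ^ 4 * b * a⁻¹) * (a * b⁻¹ * a * b ^ 2 * a * b ^ 2)⁻¹ * (a ^ 4 * b * a⁻¹)⁻¹) *
      ((a) * (a ^ 4 * b ^ 3) * (a)⁻¹) *
      ((a * b⁻¹ * a⁻¹ ^ 3) * (a ^ 4 * b ^ 3) * (a * b⁻¹ * a⁻¹ ^ 3)⁻¹) *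
      ((a * b⁻¹ * a⁻¹ ^ 4) * (a ^ 4 * b ^ 3)⁻¹ * (a * b⁻¹ * a⁻¹ ^ 4)⁻¹) *
      ((a * b ^ 2 * a ^ 2 * b⁻¹ * a⁻¹ ^ 4) * (a ^ 4 * b ^ 3) * (a * b ^ 2 * a ^ 2 * b⁻¹ * a⁻¹ ^ 4)⁻¹) *
      ((a * b⁻¹ * a⁻¹ ^ 4) * (a ^ 4 * b ^ 3) * (a * b⁻¹ * a⁻¹ ^ 4)⁻¹) *
      ((a * b⁻¹ * a⁻¹ ^ 2 * b⁻¹ * a⁻¹ ^ 2 * b⁻¹ * a⁻¹ ^ 3) * (a ^ 4 * b ^ 3)⁻¹ * (a * b⁻¹ * a⁻¹ ^ 2 * b⁻¹ * a⁻¹ ^ 2 * b⁻¹ * a⁻¹ ^ 3)⁻¹) *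
      ((a * b⁻¹ * a⁻¹ ^ 2 * b⁻¹ * a⁻¹ ^ 2) * (a ^ 4 * b ^ 3)⁻¹ * (a * b⁻¹ * a⁻¹ ^ 2 * b⁻¹ * a⁻¹ ^ 2)⁻¹) *
      ((a * b⁻¹ * a⁻¹ ^ 2 * b⁻¹ * a * b * a⁻¹) * (a * b⁻¹ * a * b ^ 2 * a * b ^ 2) * (a * b⁻¹ * a⁻¹ ^ 2 * b⁻¹ * a * b * a⁻¹)⁻¹) *
      ((a * b⁻¹ * a⁻¹ ^ 2 * b⁻¹ * a⁻¹ ^ 3) * (a ^ 4 * b ^ 3) * (a * b⁻¹ * a⁻¹ ^ 2 * b⁻¹ * a⁻¹ ^ 3)⁻¹) *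
      ((a * b⁻¹ * a⁻¹ ^ 4) * (a ^ 4 * b ^ 3)⁻¹ * (a * b⁻¹ * a⁻¹ ^ 4)⁻¹) := by
    simp [pow_succ, mul_assoc]
  rw [key, h₁, h₂]
  simp

theorem filling_generator_a (h₁ : a ^ 4 * b ^ 3 = 1) (h₂ : a * b⁻¹ * a * b ^ 2 * a * b ^ 2 = 1) :
    (a * b)⁻¹ * (b * a ^ 2)⁻¹ * (a * b) * (b * a ^ 2) = a := by
  have key : (a * b)⁻¹ * (b * a ^ 2)⁻¹ * (a * b) * (b * a ^ 2) =
      ((b⁻¹ * a⁻¹ ^ 3) * (a ^ 4 * b ^ 3)⁻¹ * (b⁻¹ * a⁻¹ ^ 3)⁻¹) *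
      ((a⁻¹) * (a * b⁻¹ * a * b ^ 2 * a * b ^ 2) * (a⁻¹)⁻¹) * a := by
    simp [pow_succ, mul_assoc]
  rw [key, h₁, h₂]
  simp

theorem filling_generator_b (h₁ : a ^ 4 * b ^ 3 = 1) (h₂ : a * b⁻¹ * a * b ^ 2 * a * b ^ 2 = 1) :
    (b * a ^ 2)⁻¹ * (a * b)⁻¹ * (b * a ^ 2) * (a * b) ^ 2 = b := by
  have key : (b * a ^ 2)⁻¹ * (a * b)⁻¹ * (b * a ^ 2) * (a * b) ^ 2 =
      ((a⁻¹ ^ 2 * b⁻¹ ^ 2 * a⁻¹ * b⁻¹ ^ 2 * a⁻¹ ^ 4) * (a ^ 4 * b ^ 3) * (a⁻¹ ^ 2 * b⁻¹ ^ 2 * a⁻¹ * b⁻¹ ^ 2 * a⁻¹ ^ 4)⁻¹) *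
      ((a⁻¹ ^ 2 * b⁻¹ ^ 2 * a⁻¹) * (a ^ 4 * b ^ 3)⁻¹ * (a⁻¹ ^ 2 * b⁻¹ ^ 2 * a⁻¹)⁻¹) *
      ((a⁻¹ ^ 2 * b⁻¹ ^ 2 * a ^ 3 * b * a⁻¹) * (a * b⁻¹ * a * b ^ 2 * a * b ^ 2)⁻¹ * (a⁻¹ ^ 2 * b⁻¹ ^ 2 * a ^ 3 * b * a⁻¹)⁻¹) *
      ((a⁻¹ ^ 2 * b⁻¹ ^ 2) * (a ^ 4 * b ^ 3) * (a⁻¹ ^ 2 * b⁻¹ ^ 2)⁻¹) *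
      ((a⁻¹ ^ 2 * b⁻¹ ^ 3 * a⁻¹ ^ 3) * (a ^ 4 * b ^ 3) * (a⁻¹ ^ 2 * b⁻¹ ^ 3 * a⁻¹ ^ 3)⁻¹) *
      ((a⁻¹ ^ 2 * b⁻¹ ^ 3 * a⁻¹ ^ 4) * (a ^ 4 * b ^ 3)⁻¹ * (a⁻¹ ^ 2 * b⁻¹ ^ 3 * a⁻¹ ^ 4)⁻¹) * b := by
    simp [pow_succ, mul_assoc]
  rw [key, h₁, h₂]
  simp

/-- Since a⁴ = b⁻³ commutes with both generators, ab²a³b = ab²a⁻¹·a⁴·b reduces to ab⁻¹a⁻¹b. -/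
theorem filling_meridian (h₁ : a ^ 4 * b ^ 3 = 1) :
    (a * b) * (b * a ^ 2) * (a * b) = a * b⁻¹ * a⁻¹ * b := by
  have key : (a * b) * (b * a ^ 2) * (a * b) =
      ((a * b⁻¹ * a⁻¹ ^ 4) * (a ^ 4 * b ^ 3) * (a * b⁻¹ * a⁻¹ ^ 4)⁻¹) * (a * b⁻¹ * a⁻¹ * b) := by
    simp [pow_succ, mul_assoc]
  rw [key, h₁]
  simp

/-- Here the relators of the target presentation are evaluated at the inverse substitution a ↦
b⁻¹a⁻¹ba, b ↦ a⁻¹b⁻¹ab²; `h₂` is the conjugated slope. -/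
theorem m023_filling_relation₁
    (h₁ : a * b⁻¹ * a⁻¹ * b ^ 2 * a⁻¹ * b⁻¹ * a * b ^ 3 = 1)
    (h₂ : a * b ^ 2 * a * b⁻¹ * a⁻¹ * b * a * b * a⁻¹ * b⁻¹ = 1) :
    (b⁻¹ * a⁻¹ * b * a) ^ 4 * (a⁻¹ * b⁻¹ * a * b ^ 2) ^ 3 = 1 := by
  have key : (b⁻¹ * a⁻¹ * b * a) ^ 4 * (a⁻¹ * b⁻¹ * a * b ^ 2) ^ 3 =
      ((b⁻¹ * a⁻¹ * b * a * b⁻¹ * a⁻¹ * b * a * b⁻¹ * a⁻¹ * b * a * b⁻¹ * a * b * a⁻¹) * (a * b⁻¹ * a⁻¹ * b ^ 2 * a⁻¹ * b⁻¹ * a * b ^ 3) * (b⁻¹ * a⁻¹ * b * a * b⁻¹ * a⁻¹ * b * a * b⁻¹ * a⁻¹ * b * a * b⁻¹ * a * b * a⁻¹)⁻¹) *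
      ((b⁻¹ * a⁻¹ * b * a * b⁻¹ * a⁻¹ * b * a * b⁻¹ * a⁻¹ * b * a * b⁻¹ ^ 2 * a * b * a⁻¹) * (a * b⁻¹ * a⁻¹ * b ^ 2 * a⁻¹ * b⁻¹ * a * b ^ 3)⁻¹ * (b⁻¹ * a⁻¹ * b * a * b⁻¹ * a⁻¹ * b * a * b⁻¹ * a⁻¹ * b * a * b⁻¹ ^ 2 * a * b * a⁻¹)⁻¹) *
      ((b⁻¹ * a⁻¹ * b * a * b⁻¹ * a⁻¹ * b) * (a * b ^ 2 * a * b⁻¹ * a⁻¹ * b * a * b * a⁻¹ * b⁻¹) * (b⁻¹ * a⁻¹ * b * a * b⁻¹ * a⁻¹ * b)⁻¹) *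
      ((b⁻¹ * a⁻¹) * (a * b ^ 2 * a * b⁻¹ * a⁻¹ * b * a * b * a⁻¹ * b⁻¹)⁻¹ * (b⁻¹ * a⁻¹)⁻¹) *
      ((b⁻¹ ^ 2 * a⁻¹ * b * a * b⁻¹ ^ 2 * a * b * a⁻¹) * (a * b⁻¹ * a⁻¹ * b ^ 2 * a⁻¹ * b⁻¹ * a * b ^ 3) * (b⁻¹ ^ 2 * a⁻¹ * b * a * b⁻¹ ^ 2 * a * b * a⁻¹)⁻¹) := by
    simp [pow_succ, mul_assoc]
  rw [key, h₁, h₂]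
  simp

theorem m023_filling_relation₂
    (h₁ : a * b⁻¹ * a⁻¹ * b ^ 2 * a⁻¹ * b⁻¹ * a * b ^ 3 = 1)
    (h₂ : a * b ^ 2 * a * b⁻¹ * a⁻¹ * b * a * b * a⁻¹ * b⁻¹ = 1) :
    (b⁻¹ * a⁻¹ * b * a) * (a⁻¹ * b⁻¹ * a * b ^ 2)⁻¹ * (b⁻¹ * a⁻¹ * b * a) *
      (a⁻¹ * b⁻¹ * a * b ^ 2) ^ 2 * (b⁻¹ * a⁻¹ * b * a) * (a⁻¹ * b⁻¹ * a * b ^ 2) ^ 2 = 1 := by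
  have key : (b⁻¹ * a⁻¹ * b * a) * (a⁻¹ * b⁻¹ * a * b ^ 2)⁻¹ * (b⁻¹ * a⁻¹ * b * a) *
      (a⁻¹ * b⁻¹ * a * b ^ 2) ^ 2 * (b⁻¹ * a⁻¹ * b * a) * (a⁻¹ * b⁻¹ * a * b ^ 2) ^ 2 =
      ((b⁻¹ * a⁻¹ * b * a * b⁻¹ ^ 2 * a⁻¹ * b * a * b⁻¹ * a * b * a⁻¹) * (a * b⁻¹ * a⁻¹ * b ^ 2 * a⁻¹ * b⁻¹ * a * b ^ 3) * (b⁻¹ * a⁻¹ * b * a * b⁻¹ ^ 2 * a⁻¹ * b * a * b⁻¹ * a * b * a⁻¹)⁻¹) *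
      ((b⁻¹ * a⁻¹ * b * a * b⁻¹ ^ 2 * a⁻¹ * b * a * b⁻¹ ^ 2 * a * b * a⁻¹) * (a * b⁻¹ * a⁻¹ * b ^ 2 * a⁻¹ * b⁻¹ * a * b ^ 3)⁻¹ * (b⁻¹ * a⁻¹ * b * a * b⁻¹ ^ 2 * a⁻¹ * b * a * b⁻¹ ^ 2 * a * b * a⁻¹)⁻¹) *
      ((b⁻¹ * a⁻¹ * b * a * b⁻¹ * a⁻¹) * (a * b ^ 2 * a * b⁻¹ * a⁻¹ * b * a * b * a⁻¹ * b⁻¹) * (b⁻¹ * a⁻¹ * b * a * b⁻¹ * a⁻¹)⁻¹) *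
      ((b⁻¹ * a⁻¹) * (a * b ^ 2 * a * b⁻¹ * a⁻¹ * b * a * b * a⁻¹ * b⁻¹)⁻¹ * (b⁻¹ * a⁻¹)⁻¹) *
      ((b⁻¹ ^ 2 * a⁻¹ * b * a * b⁻¹ ^ 2 * a * b * a⁻¹) * (a * b⁻¹ * a⁻¹ * b ^ 2 * a⁻¹ * b⁻¹ * a * b ^ 3) * (b⁻¹ ^ 2 * a⁻¹ * b * a * b⁻¹ ^ 2 * a * b * a⁻¹)⁻¹) := by
    simp [pow_succ, mul_assoc]
  rw [key, h₁, h₂]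
  simp

/-- This is the image of ba² under the inverse substitution. The image of ab needs no such lemma,
since it reduces freely to b. -/
theorem m023_filling_generator
    (h₁ : a * b⁻¹ * a⁻¹ * b ^ 2 * a⁻¹ * b⁻¹ * a * b ^ 3 = 1)
    (h₂ : a * b ^ 2 * a * b⁻¹ * a⁻¹ * b * a * b * a⁻¹ * b⁻¹ = 1) :
    (a⁻¹ * b⁻¹ * a * b ^ 2) * (b⁻¹ * a⁻¹ * b * a) ^ 2 = a := by
  have key : (a⁻¹ * b⁻¹ * a * b ^ 2) * (b⁻¹ * a⁻¹ * b * a) ^ 2 =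
      ((a⁻¹ * b⁻¹ * a * b * a⁻¹) * (a * b ^ 2 * a * b⁻¹ * a⁻¹ * b * a * b * a⁻¹ * b⁻¹)⁻¹ * (a⁻¹ * b⁻¹ * a * b * a⁻¹)⁻¹) *
      ((b⁻¹ ^ 2 * a * b * a⁻¹) * (a * b⁻¹ * a⁻¹ * b ^ 2 * a⁻¹ * b⁻¹ * a * b ^ 3) * (b⁻¹ ^ 2 * a * b * a⁻¹)⁻¹) * a := by
    simp [pow_succ, mul_assoc]
  rw [key, h₁, h₂]
  simp

end GroupIdentities

/-! ### The isomorphism between the filling group and its two-relator presentation -/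

theorem filling_rel₁ {G : Type*} [Group G] (f : FillingPresentation →* G) :
    (f (.of 0)) ^ 4 * (f (.of 1)) ^ 3 = 1 := by
  have h : PresentedGroup.mk fillingRels (.of 0 ^ 4 * .of 1 ^ 3) = 1 :=
    PresentedGroup.one_of_mem (by simp [fillingRels])
  have := congrArg f h
  simp only [map_mul, map_pow, map_one] at this
  exact this

theorem filling_rel₂ {G : Type*} [Group G] (f : FillingPresentation →* G) :
    f (.of 0) * (f (.of 1))⁻¹ * f (.of 0) * (f (.of 1)) ^ 2 * f (.of 0) * (f (.of 1)) ^ 2 = 1 := by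
  have h : PresentedGroup.mk fillingRels
      (.of 0 * (.of 1)⁻¹ * .of 0 * .of 1 ^ 2 * .of 0 * .of 1 ^ 2) = 1 :=
    PresentedGroup.one_of_mem (by simp [fillingRels])
  have := congrArg f h
  simp only [map_mul, map_pow, map_one, map_inv] at this
  exact this

theorem m023_rel {G : Type*} [Group G] (f : M023 →* G) :
    f (.of 0) * (f (.of 1))⁻¹ * (f (.of 0))⁻¹ * f (.of 1) ^ 2 * (f (.of 0))⁻¹ * (f (.of 1))⁻¹ *
      f (.of 0) * f (.of 1) ^ 3 = 1 := by
  have h : PresentedGroup.mk m023Rels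
      (.of 0 * (.of 1)⁻¹ * (.of 0)⁻¹ * .of 1 ^ 2 * (.of 0)⁻¹ * (.of 1)⁻¹ * .of 0 * .of 1 ^ 3) = 1 :=
    PresentedGroup.one_of_mem (by simp [m023Rels])
  have := congrArg f h
  simp only [map_mul, map_pow, map_one, map_inv] at this
  exact this

/-- The morphism `π₁(m023) → ⟨a,b | a⁴b³, ab⁻¹ab²ab²⟩`, `a ↦ ba²`, `b ↦ ab`. -/
def m023ToPresentation : M023 →* FillingPresentation :=
  PresentedGroup.toGroup (f := ![.of 1 * .of 0 ^ 2, .of 0 * .of 1]) <| by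
    rintro w rfl
    simpa using filling_relation₁ (filling_rel₁ (.id _)) (filling_rel₂ (.id _))

@[simp] theorem m023ToPresentation_zero :
    m023ToPresentation (.of 0) = .of 1 * .of 0 ^ 2 := PresentedGroup.toGroup.of _

@[simp] theorem m023ToPresentation_one :
    m023ToPresentation (.of 1) = .of 0 * .of 1 := PresentedGroup.toGroup.of _

theorem m023ToPresentation_meridian : m023ToPresentation meridian = fillingCurve := by
  simpa [meridian, fillingCurve] using filling_meridian (filling_rel₁ (.id _))

/-- The slope is b times the displayed word times b⁻¹ after free reduction; the shorter word is the
one used in the certificates. -/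
theorem slope_eq_one_iff {G : Type*} [Group G] (f : M023 →* G) :
    f (meridian ^ (2 : ℤ) * longitude ^ (-1 : ℤ)) = 1 ↔
      f (.of 0) * f (.of 1) ^ 2 * f (.of 0) * (f (.of 1))⁻¹ * (f (.of 0))⁻¹ * f (.of 1) *
        f (.of 0) * f (.of 1) * (f (.of 0))⁻¹ * (f (.of 1))⁻¹ = 1 := by
  generalize hw : f (.of 0) * f (.of 1) ^ 2 * f (.of 0) * (f (.of 1))⁻¹ * (f (.of 0))⁻¹ *
    f (.of 1) * f (.of 0) * f (.of 1) * (f (.of 0))⁻¹ * (f (.of 1))⁻¹ = w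
  have : f (meridian ^ (2 : ℤ) * longitude ^ (-1 : ℤ)) = f (.of 1) * w * (f (.of 1))⁻¹ := by
    rw [← hw]
    simp [meridian, longitude, pow_succ, mul_assoc, zpow_ofNat]
  rw [this, conj_eq_one_iff]

/-- The isomorphism `π₁(m023(2,-1)) ≃ ⟨a,b | a⁴b³, ab⁻¹ab²ab²⟩` in the direction `a ↦ ba²`,
`b ↦ ab`. -/
def fillingHom : M023Filling 2 (-1) →* FillingPresentation :=
  QuotientGroup.lift _ m023ToPresentation <| by
    have : Subgroup.normalClosure {meridian ^ (2 : ℤ) * longitude ^ (-1 : ℤ)} ≤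
        m023ToPresentation.ker := by
      apply Subgroup.normalClosure_le_normal
      rintro _ rfl
      refine (slope_eq_one_iff _).2 ?_
      simpa using filling_relation₂ (filling_rel₁ (.id _)) (filling_rel₂ (.id _))
    exact fun x hx => this hx

theorem filling_slope :
    (QuotientGroup.mk' _ : M023 →* M023Filling 2 (-1))
      (meridian ^ (2 : ℤ) * longitude ^ (-1 : ℤ)) = 1 :=
  (QuotientGroup.eq_one_iff _).2 (Subgroup.subset_normalClosure rfl)

theorem fillingInv_rels : ∀ w ∈ fillingRels, FreeGroup.lift
    (let p : M023 →* M023Filling 2 (-1) := QuotientGroup.mk' _;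
      ![(p (.of 1))⁻¹ * (p (.of 0))⁻¹ * p (.of 1) * p (.of 0),
        (p (.of 0))⁻¹ * (p (.of 1))⁻¹ * p (.of 0) * p (.of 1) ^ 2]) w = 1 := by
  set p : M023 →* M023Filling 2 (-1) := QuotientGroup.mk' _
  have h₁ := m023_rel p
  have h₂ := (slope_eq_one_iff p).1 filling_slope
  rintro w (rfl | rfl)
  · simp only [map_mul, map_pow, FreeGroup.lift_apply_of]
    exact m023_filling_relation₁ h₁ h₂
  · simp only [map_mul, map_pow, map_inv, FreeGroup.lift_apply_of]
    exact m023_filling_relation₂ h₁ h₂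

/-- The inverse morphism `a ↦ b⁻¹a⁻¹ba`, `b ↦ a⁻¹b⁻¹ab²`. -/
def fillingInv : FillingPresentation →* M023Filling 2 (-1) :=
  PresentedGroup.toGroup fillingInv_rels

theorem fillingInv_comp_fillingHom : fillingInv.comp fillingHom = .id _ := by
  set p : M023 →* M023Filling 2 (-1) := QuotientGroup.mk' _ with hp
  have h₁ := m023_rel p
  have h₂ := (slope_eq_one_iff p).1 filling_slope
  have e0 : fillingInv (.of 0) = (p (.of 1))⁻¹ * (p (.of 0))⁻¹ * p (.of 1) * p (.of 0) :=
    PresentedGroup.toGroup.of fillingInv_rels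
  have e1 : fillingInv (.of 1) = (p (.of 0))⁻¹ * (p (.of 1))⁻¹ * p (.of 0) * p (.of 1) ^ 2 :=
    PresentedGroup.toGroup.of fillingInv_rels
  apply QuotientGroup.monoidHom_ext
  apply PresentedGroup.ext
  intro i
  fin_cases i
  · change fillingInv (m023ToPresentation (.of 0)) = p (.of 0)
    rw [m023ToPresentation_zero, map_mul, map_pow, e0, e1]
    exact m023_filling_generator h₁ h₂
  · change fillingInv (m023ToPresentation (.of 1)) = p (.of 1)
    rw [m023ToPresentation_one, map_mul, e0, e1]
    simp [pow_succ, mul_assoc]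

theorem fillingHom_comp_fillingInv : fillingHom.comp fillingInv = .id _ := by
  set p : M023 →* M023Filling 2 (-1) := QuotientGroup.mk' _ with hp
  have e0 : fillingInv (.of 0) = (p (.of 1))⁻¹ * (p (.of 0))⁻¹ * p (.of 1) * p (.of 0) :=
    PresentedGroup.toGroup.of fillingInv_rels
  have e1 : fillingInv (.of 1) = (p (.of 0))⁻¹ * (p (.of 1))⁻¹ * p (.of 0) * p (.of 1) ^ 2 :=
    PresentedGroup.toGroup.of fillingInv_rels
  have f0 : fillingHom (p (.of 0)) = .of 1 * .of 0 ^ 2 := m023ToPresentation_zero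
  have f1 : fillingHom (p (.of 1)) = .of 0 * .of 1 := m023ToPresentation_one
  have h₁ := filling_rel₁ (.id FillingPresentation)
  have h₂ := filling_rel₂ (.id FillingPresentation)
  apply PresentedGroup.ext
  intro i
  fin_cases i
  · change fillingHom (fillingInv (.of 0)) = .of 0
    simp only [e0, map_mul, map_inv, f0, f1]
    exact filling_generator_a h₁ h₂
  · change fillingHom (fillingInv (.of 1)) = .of 1
    simp only [e1, map_mul, map_inv, map_pow, f0, f1]
    exact filling_generator_b h₁ h₂

/-- `π₁(m023(2,-1)) ≃ ⟨a,b | a⁴b³, ab⁻¹ab²ab²⟩`. -/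
def fillingEquiv : M023Filling 2 (-1) ≃* FillingPresentation :=
  fillingHom.toMulEquiv fillingInv fillingInv_comp_fillingHom fillingHom_comp_fillingInv

theorem fillingEquiv_mk (h : M023) :
    fillingEquiv (QuotientGroup.mk h) = m023ToPresentation h := rfl

theorem m023ToPresentation_longitude :
    m023ToPresentation longitude = fillingCurve * fillingCurve := by
  have h : m023ToPresentation (meridian ^ (2 : ℤ) * longitude ^ (-1 : ℤ)) = 1 := by
    have := congrArg fillingHom filling_slope
    rwa [map_one] at this
  rw [map_mul, map_zpow, map_zpow, m023ToPresentation_meridian, zpow_neg_one,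
    mul_inv_eq_one] at h
  rw [← h, zpow_ofNat, sq]

/-! ### The surjection onto the triangle group and the image of the cusp -/

theorem triangle₂_rels {p q r : ℕ} {G : Type*} [Group G] (f : TriangleGroup₂ p q r →* G) :
    f (genX p q r) ^ p = 1 ∧ f (genY p q r) ^ q = 1 ∧
      (f (genX p q r) * f (genY p q r)) ^ r = 1 := by
  have h₁ : PresentedGroup.mk (triangleRels₂ p q r) (.of 0 ^ p) = 1 :=
    PresentedGroup.one_of_mem (by simp [triangleRels₂])
  have h₂ : PresentedGroup.mk (triangleRels₂ p q r) (.of 1 ^ q) = 1 :=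
    PresentedGroup.one_of_mem (by simp [triangleRels₂])
  have h₃ : PresentedGroup.mk (triangleRels₂ p q r) ((.of 0 * .of 1) ^ r) = 1 :=
    PresentedGroup.one_of_mem (by simp [triangleRels₂])
  replace h₁ := congrArg f h₁
  replace h₂ := congrArg f h₂
  replace h₃ := congrArg f h₃
  simp only [map_mul, map_pow, map_one] at h₁ h₂ h₃
  exact ⟨h₁, h₂, h₃⟩

/-- The morphism `a ↦ xy`, `b ↦ x`. -/
def presentationToTriangle : FillingPresentation →* TriangleGroup₂ 3 3 4 :=
  PresentedGroup.toGroup (f := ![genX 3 3 4 * genY 3 3 4, genX 3 3 4]) <| by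
    obtain ⟨h₁, h₂, h₃⟩ := triangle₂_rels (.id (TriangleGroup₂ 3 3 4))
    simp only [MonoidHom.id_apply] at h₁ h₂ h₃
    have hx : genX 3 3 4 ^ 2 = (genX 3 3 4)⁻¹ := by
      rw [eq_inv_iff_mul_eq_one, ← pow_succ, h₁]
    rintro w (rfl | rfl)
    · simp [h₁, h₃]
    · have : genX 3 3 4 * genY 3 3 4 ^ 3 * (genX 3 3 4)⁻¹ = 1 := by rw [h₂]; simp
      simpa [hx, pow_succ _ 2, sq (genY 3 3 4), mul_assoc] using this

@[simp] theorem presentationToTriangle_zero :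
    presentationToTriangle (.of 0) = genX 3 3 4 * genY 3 3 4 := PresentedGroup.toGroup.of _

@[simp] theorem presentationToTriangle_one :
    presentationToTriangle (.of 1) = genX 3 3 4 := PresentedGroup.toGroup.of _

theorem presentationToTriangle_fillingCurve :
    presentationToTriangle fillingCurve = genComm 3 3 4 := by
  simp [fillingCurve, genComm, mul_assoc]

theorem presentationToTriangle_surjective : Function.Surjective presentationToTriangle := by
  rw [← MonoidHom.range_eq_top, eq_top_iff, ← PresentedGroup.closure_range_of,
    Subgroup.closure_le]
  rintro _ ⟨i, rfl⟩
  fin_cases i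
  · exact ⟨.of 1, presentationToTriangle_one⟩
  · refine ⟨(.of 1)⁻¹ * .of 0, ?_⟩
    simp [genY]

/-- The morphism `π₁(m023) → Λ₂(3,3,4)`. -/
def m023ToTriangle : M023 →* TriangleGroup₂ 3 3 4 :=
  presentationToTriangle.comp m023ToPresentation

theorem m023ToTriangle_surjective : Function.Surjective m023ToTriangle :=
  presentationToTriangle_surjective.comp
    (fun x => ⟨(fillingEquiv.symm x).out, by
      rw [← fillingEquiv_mk, QuotientGroup.out_eq', MulEquiv.apply_symm_apply]⟩)

/-- The two peripheral generators go to η([x,y]) and its square, so the image is cyclic and both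
unipotent generators may be taken equal. -/
theorem isBoundaryUnipotent_comp {η : TriangleGroup₂ 3 3 4 →* PU21}
    (h : IsUnipotent (η (genComm 3 3 4))) : IsBoundaryUnipotent (η.comp m023ToTriangle) := by
  have hm : (η.comp m023ToTriangle) meridian = η (genComm 3 3 4) := by
    simp [m023ToTriangle, m023ToPresentation_meridian, presentationToTriangle_fillingCurve]
  have hl : (η.comp m023ToTriangle) longitude = η (genComm 3 3 4) * η (genComm 3 3 4) := by
    simp [m023ToTriangle, m023ToPresentation_longitude, presentationToTriangle_fillingCurve]
  refine ⟨_, _, h, h, Commute.refl _, ?_⟩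
  rw [peripheral, MonoidHom.map_closure, Set.image_pair, hm, hl, Set.pair_eq_singleton]
  apply le_antisymm
  · rw [Subgroup.closure_le]
    rintro _ (rfl | rfl)
    · exact Subgroup.mem_closure_singleton_self _
    · exact mul_mem (Subgroup.mem_closure_singleton_self _) (Subgroup.mem_closure_singleton_self _)
  · exact Subgroup.closure_mono (by simp)

end CRTriangle

namespace CRTriangle

open Matrix ComplexConjugate

/-! ### Matrices of `U(2,1)` -/

namespace U21

/-- The Gram matrix of the Hermitian product. -/
def gram : Matrix (Fin 3) (Fin 3) ℂ := Matrix.diagonal ![1, 1, -1]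

theorem gram_mul_gram : gram * gram = 1 := by
  rw [gram, diagonal_mul_diagonal, ← diagonal_one]
  congr 1; ext i; fin_cases i <;> simp

theorem herm_eq_dotProduct (z w : Fin 3 → ℂ) : herm z w = star w ⬝ᵥ gram *ᵥ z := by
  simp [herm, gram, dotProduct, Fin.sum_univ_three, mulVec_diagonal]
  ring

theorem herm_mulVec (A : Matrix (Fin 3) (Fin 3) ℂ) (z w : Fin 3 → ℂ) :
    herm (A *ᵥ z) (A *ᵥ w) = star w ⬝ᵥ (Aᴴ * gram * A) *ᵥ z := by
  rw [herm_eq_dotProduct, star_mulVec, ← mulVec_mulVec, ← mulVec_mulVec, ← dotProduct_mulVec]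

theorem conjTranspose_mul_gram_mul (A : U21) : (mat A)ᴴ * gram * mat A = gram := by
  apply Matrix.ext_of_mulVec_single
  intro i
  ext j
  have h := A.2 (Pi.single i 1) (Pi.single j 1)
  change herm (mat A *ᵥ _) (mat A *ᵥ _) = _ at h
  rw [herm_mulVec, herm_eq_dotProduct] at h
  simpa using h

/-- The element of `U(2,1)` with a given matrix. -/
def ofMatrix (A : Matrix (Fin 3) (Fin 3) ℂ) (h : Aᴴ * gram * A = gram) : U21 :=
  ⟨⟨A, gram * Aᴴ * gram, mul_eq_one_comm.1 (by
      rw [mul_assoc gram, mul_assoc gram, h, gram_mul_gram]), by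
      rw [mul_assoc gram, mul_assoc gram, h, gram_mul_gram]⟩, by
    intro z w
    rw [herm_mulVec, h, herm_eq_dotProduct]⟩

theorem mat_mul (A B : U21) : mat (A * B) = mat A * mat B := rfl

theorem mat_one : mat 1 = 1 := rfl

theorem mat_pow (A : U21) (n : ℕ) : mat (A ^ n) = mat A ^ n := by
  induction n with
  | zero => rfl
  | succ n ih => rw [pow_succ, mat_mul, ih, pow_succ]

theorem mat_mul_mat_inv (A : U21) : mat A * mat A⁻¹ = 1 := by
  rw [← mat_mul, mul_inv_cancel, mat_one]

theorem mat_inv_mul_mat (A : U21) : mat A⁻¹ * mat A = 1 := by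
  rw [← mat_mul, inv_mul_cancel, mat_one]

theorem mat_injective : Function.Injective mat := fun _ _ h =>
  Subtype.ext (Units.ext h)

theorem mat_inv (A : U21) : mat A⁻¹ = gram * (mat A)ᴴ * gram := by
  have h : gram * (mat A)ᴴ * gram * mat A = 1 := by
    rw [mul_assoc gram, mul_assoc gram, conjTranspose_mul_gram_mul, gram_mul_gram]
  calc mat A⁻¹ = gram * (mat A)ᴴ * gram * mat A * mat A⁻¹ := by rw [h, one_mul]
    _ = _ := by rw [mul_assoc, mat_mul_mat_inv, mul_one]

/-- The inverse is conjugate by the Gram matrix to the adjoint. Every reality argument on traces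
below rests on this. -/
theorem trace_mat_inv (A : U21) : (mat A⁻¹).trace = conj (mat A).trace := by
  rw [mat_inv, trace_mul_comm, ← mul_assoc, gram_mul_gram, one_mul, trace_conjTranspose]
  rfl

theorem det_gram : gram.det = -1 := by
  simp [gram, det_diagonal, Fin.prod_univ_three]

theorem normSq_det (A : U21) : Complex.normSq (mat A).det = 1 := by
  have h := congrArg det (conjTranspose_mul_gram_mul A)
  rw [det_mul, det_mul, det_conjTranspose, det_gram] at h
  have : ((Complex.normSq (mat A).det : ℝ) : ℂ) = 1 := by
    rw [Complex.normSq_eq_conj_mul_self]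
    change star _ * _ = _
    linear_combination -h
  exact_mod_cast this

/-- Multiplication by a scalar of modulus one. -/
def smul (c : ℂ) (hc : Complex.normSq c = 1) (A : U21) : U21 :=
  ofMatrix (c • mat A) <| by
    have : star c * c = 1 := by
      have := Complex.normSq_eq_conj_mul_self (z := c)
      rw [hc] at this
      exact_mod_cast this.symm
    rw [conjTranspose_smul, smul_mul_assoc, smul_mul_assoc, mul_smul_comm, smul_smul, this,
      conjTranspose_mul_gram_mul, one_smul]

@[simp] theorem mat_smul (c : ℂ) (hc : Complex.normSq c = 1) (A : U21) :
    mat (smul c hc A) = c • mat A := rfl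

theorem proj_eq_iff {A B : U21} : proj A = proj B ↔ ∃ c : ℂ, mat A = c • mat B := by
  have : proj A = proj B ↔ B⁻¹ * A ∈ scalars := by
    rw [eq_comm]
    exact QuotientGroup.eq
  rw [this]
  constructor
  · rintro ⟨c, hc⟩
    refine ⟨c, ?_⟩
    rw [show A = B * (B⁻¹ * A) by group, mat_mul, hc, mul_smul_comm, mul_one]
  · rintro ⟨c, hc⟩
    exact ⟨c, by rw [mat_mul, hc, mul_smul_comm, mat_inv_mul_mat]⟩

theorem proj_eq_one_iff {A : U21} : proj A = 1 ↔ ∃ c : ℂ, mat A = c • (1 : Matrix _ _ ℂ) := by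
  rw [← map_one proj, proj_eq_iff, mat_one]

theorem proj_smul (c : ℂ) (hc : Complex.normSq c = 1) (A : U21) : proj (smul c hc A) = proj A :=
  proj_eq_iff.2 ⟨c, rfl⟩

theorem proj_surjective : Function.Surjective proj := QuotientGroup.mk'_surjective _

theorem normSq_eq_one_of_mat_eq_smul {A B : U21} {c : ℂ} (h : mat A = c • mat B) :
    Complex.normSq c = 1 := by
  have := normSq_det A
  rw [h, det_smul, map_mul, normSq_det, mul_one, map_pow, Fintype.card_fin] at this
  exact (pow_eq_one_iff_of_nonneg (Complex.normSq_nonneg c) (by norm_num)).1 this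

/-- Any lift A has Aⁿ = c with |c| = 1, and rescaling by an n-th root of c⁻¹ stays in U(2,1). -/
theorem exists_lift_pow_eq_one {g : PU21} {n : ℕ} (hn : n ≠ 0) (h : g ^ n = 1) :
    ∃ A : U21, proj A = g ∧ mat A ^ n = 1 := by
  obtain ⟨A, rfl⟩ := proj_surjective g
  rw [← map_pow, proj_eq_one_iff] at h
  obtain ⟨c, hc⟩ := h
  have hc1 : Complex.normSq c = 1 := normSq_eq_one_of_mat_eq_smul (B := 1) hc
  obtain ⟨s, hs⟩ := IsAlgClosed.exists_pow_nat_eq c⁻¹ (Nat.pos_of_ne_zero hn)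
  have hs1 : Complex.normSq s = 1 := by
    have := congrArg Complex.normSq hs
    rw [map_pow, map_inv₀, hc1, inv_one] at this
    exact (pow_eq_one_iff_of_nonneg (Complex.normSq_nonneg s) hn).1 this
  have hc0 : c ≠ 0 := by rintro rfl; simp at hc1
  refine ⟨smul s hs1 A, proj_smul _ _ _, ?_⟩
  rw [mat_smul, smul_pow, hs, ← mat_pow, hc, smul_smul, inv_mul_cancel₀ hc0, one_smul]

end U21

/-! ### Traces of complex triangle groups -/

open U21

/-- The eigenvalues are 1 on v and −1 twice on its orthogonal complement, so the given lift already
has determinant one. -/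
theorem IsComplexReflection.exists_lift {v : Fin 3 → ℂ} {g : PU21}
    (h : IsComplexReflection v g) : ∃ A : U21, proj A = g ∧ A * A = 1 ∧ (mat A).det = 1 := by
  obtain ⟨hv, A, hA, hz⟩ := h
  have hv0 : herm v v ≠ 0 := by
    intro h0; rw [h0] at hv; simp at hv
  have hadd : ∀ z w, herm (z + w) v = herm z v + herm w v := by
    intro z w; simp [herm]; ring
  have hsmul : ∀ (c : ℂ) z, herm (c • z) v = c * herm z v := by
    intro c z; simp [herm]; ring
  have hneg : ∀ z, herm (-z) v = -herm z v := by
    intro z; simp [herm]; ring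
  refine ⟨A, hA, mat_injective ?_, ?_⟩
  · apply Matrix.ext_of_mulVec_single
    intro i
    rw [mat_mul, ← mulVec_mulVec, hz, hz, hadd, hneg, hsmul, mat_one, one_mulVec]
    ext j
    simp only [Pi.add_apply, Pi.neg_apply, Pi.smul_apply, smul_eq_mul]
    field_simp
    ring
  · obtain ⟨k, hk⟩ : ∃ k, k * herm v v = 2 := ⟨2 / herm v v, div_mul_cancel₀ _ hv0⟩
    have hent : ∀ i j, mat A i j =
        -(1 : Matrix (Fin 3) (Fin 3) ℂ) i j + k * herm (Pi.single j 1) v * v i := by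
      intro i j
      have := congrFun (hz (Pi.single j 1)) i
      rw [mulVec_single_one, ← hk, mul_assoc, mul_comm (herm v v), ← mul_assoc,
        mul_div_cancel_right₀ _ hv0] at this
      simpa [Matrix.one_apply, Pi.single_apply, Matrix.col] using this
    rw [det_fin_three]
    simp only [hent]
    simp [herm] at hk ⊢
    linear_combination hk

/-- The lift I₁·I₂I₃I₂ is a product of two involutions, with inverse I₂I₃I₂·I₁. Both orders have the
same trace, which therefore equals its conjugate. -/
theorem hasRealTrace_of_isComplexTriangle {p q r : ℕ} {θ : ℝ} {γ : TriangleGroup p q r →* PU21}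
    (h : IsComplexTriangle θ γ) :
    HasRealTrace ((γ.comp (incl p q r)) (genX p q r * (genY p q r)⁻¹)) := by
  obtain ⟨v, hv, -⟩ := h
  obtain ⟨A₀, hA₀, h₀, d₀⟩ := (hv 0).exists_lift
  obtain ⟨A₁, hA₁, h₁, d₁⟩ := (hv 1).exists_lift
  obtain ⟨A₂, hA₂, h₂, d₂⟩ := (hv 2).exists_lift
  have i₁ : A₁⁻¹ = A₁ := inv_eq_of_mul_eq_one_left h₁
  have i₂ : A₂⁻¹ = A₂ := inv_eq_of_mul_eq_one_left h₂
  have i₀ : A₀⁻¹ = A₀ := inv_eq_of_mul_eq_one_left h₀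
  have hx : incl p q r (genX p q r) = .of 0 * .of 1 := PresentedGroup.toGroup.of _
  have hy : incl p q r (genY p q r) = .of 1 * .of 2 := PresentedGroup.toGroup.of _
  refine ⟨A₀ * A₁ * (A₁ * A₂)⁻¹, ?_, ?_, ?_⟩
  · simp only [MonoidHom.comp_apply, map_mul, map_inv, hx, hy, hA₀, hA₁, hA₂]
  · rw [_root_.mul_inv_rev, i₁, i₂]
    simp [mat_mul, d₀, d₁, d₂]
  · have e : (A₀ * A₁ * (A₁ * A₂)⁻¹)⁻¹ = A₁ * A₂ * A₁ * A₀ := by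
      simp only [_root_.mul_inv_rev, inv_inv, i₀, i₁]; group
    have e' : A₀ * A₁ * (A₁ * A₂)⁻¹ = A₀ * (A₁ * A₂ * A₁) := by
      rw [_root_.mul_inv_rev, i₁, i₂]; group
    have := trace_mat_inv (A₀ * A₁ * (A₁ * A₂)⁻¹)
    rw [e, e', mat_mul, mat_mul A₀, trace_mul_comm] at this
    rw [e', mat_mul]
    exact Complex.conj_eq_iff_im.1 this.symm

end CRTriangle

namespace CRTriangle

open Matrix ComplexConjugate

/-! ### Three by three matrices of finite order -/

/-- Idempotent matrices of rank one. -/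
def IsRankOneProj (E : Matrix (Fin 3) (Fin 3) ℂ) : Prop :=
  ∃ u v : Fin 3 → ℂ, E = vecMulVec u v ∧ v ⬝ᵥ u = 1

/-- For E = uvᵗ the middle factor of EAE is the scalar vᵗAu, which is tr(AE). -/
theorem IsRankOneProj.mul_mul {E : Matrix (Fin 3) (Fin 3) ℂ} (h : IsRankOneProj E)
    (A : Matrix (Fin 3) (Fin 3) ℂ) : E * A * E = (A * E).trace • E := by
  obtain ⟨u, v, rfl, -⟩ := h
  rw [vecMulVec_mul, vecMulVec_mul_vecMulVec, mul_vecMulVec, trace_vecMulVec, dotProduct_comm _ v,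
    dotProduct_mulVec, vecMulVec_smul]

theorem IsRankOneProj.trace {E : Matrix (Fin 3) (Fin 3) ℂ} (h : IsRankOneProj E) :
    E.trace = 1 := by
  obtain ⟨u, v, rfl, h⟩ := h
  rw [trace_vecMulVec, dotProduct_comm, h]

theorem IsRankOneProj.mul_self {E : Matrix (Fin 3) (Fin 3) ℂ} (h : IsRankOneProj E) :
    E * E = E := by
  have := h.mul_mul 1
  rwa [mul_one, one_mul, h.trace, one_smul] at this

/-- The trace of an idempotent is its rank, so the columns are multiples of one vector. -/
theorem isRankOneProj_of_trace_eq_one {E : Matrix (Fin 3) (Fin 3) ℂ} (h : E * E = E)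
    (ht : E.trace = 1) : IsRankOneProj E := by
  have hE : IsIdempotentElem (toLin' E) := by
    rw [IsIdempotentElem, Module.End.mul_eq_comp, ← toLin'_mul, h]
  have h1 : Module.finrank ℂ (LinearMap.range (toLin' E)) = 1 := by
    have := (LinearMap.IsIdempotentElem.isProj_range _ hE).trace
    rw [trace_toLin'_eq, ht] at this
    exact_mod_cast this.symm
  obtain ⟨⟨u, hu⟩, hu0, hspan⟩ := finrank_eq_one_iff'.1 h1
  have : ∀ j, ∃ c : ℂ, c • u = E.col j := by
    intro j
    obtain ⟨c, hc⟩ := hspan ⟨E *ᵥ Pi.single j 1, ⟨_, rfl⟩⟩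
    exact ⟨c, by simpa using congrArg Subtype.val hc⟩
  choose v hv using this
  have hEv : E = vecMulVec u v := by
    ext i j
    rw [vecMulVec_apply, ← col_apply E j i, ← hv j, Pi.smul_apply, smul_eq_mul, mul_comm]
  refine ⟨u, v, hEv, ?_⟩
  rw [hEv, trace_vecMulVec, dotProduct_comm] at ht
  exact ht

theorem eq_zero_of_mul_self_of_trace {E : Matrix (Fin 3) (Fin 3) ℂ} (h : E * E = E)
    (ht : E.trace = 0) : E = 0 := by
  have hE : IsIdempotentElem (toLin' E) := by
    rw [IsIdempotentElem, Module.End.mul_eq_comp, ← toLin'_mul, h]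
  have := (LinearMap.IsIdempotentElem.trace_eq_zero_iff hE).1 (by rw [trace_toLin'_eq, ht])
  simpa using this

theorem exists_trace_eq_natCast {E : Matrix (Fin 3) (Fin 3) ℂ} (h : E * E = E) :
    ∃ n : ℕ, n ≤ 3 ∧ E.trace = n := by
  have hE : IsIdempotentElem (toLin' E) := by
    rw [IsIdempotentElem, Module.End.mul_eq_comp, ← toLin'_mul, h]
  refine ⟨_, ?_, by rw [← (LinearMap.IsIdempotentElem.isProj_range _ hE).trace, trace_toLin'_eq]⟩
  simpa using Submodule.finrank_le (LinearMap.range (toLin' E))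

theorem idempotent_cases {E : Matrix (Fin 3) (Fin 3) ℂ} (h : E * E = E) :
    E = 0 ∨ E = 1 ∨ IsRankOneProj E ∨ IsRankOneProj (1 - E) := by
  have h' : (1 - E) * (1 - E) = 1 - E := by
    rw [sub_mul, mul_sub, mul_sub, h]; simp
  have ht' : (1 - E).trace = 3 - E.trace := by simp [trace_sub]
  obtain ⟨n, hn, ht⟩ := exists_trace_eq_natCast h
  rw [ht] at ht'
  interval_cases n
  · exact Or.inl (eq_zero_of_mul_self_of_trace h (by simpa using ht))
  · exact Or.inr (Or.inr (Or.inl (isRankOneProj_of_trace_eq_one h (by simpa using ht))))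
  · exact Or.inr (Or.inr (Or.inr (isRankOneProj_of_trace_eq_one h' (by rw [ht']; norm_num))))
  · have := eq_zero_of_mul_self_of_trace h' (by rw [ht']; norm_num)
    exact Or.inr (Or.inl (sub_eq_zero.1 this).symm)

theorem exists_eigenvalues (Z : Matrix (Fin 3) (Fin 3) ℂ) {n : ℕ} {c : ℂ}
    (h : Z ^ n = c • (1 : Matrix (Fin 3) (Fin 3) ℂ)) :
    ∃ r s t : ℂ, r ^ n = c ∧ s ^ n = c ∧ t ^ n = c ∧ Z.det = r * s * t ∧ Z.trace = r + s + t ∧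
      (Z - r • (1 : Matrix (Fin 3) (Fin 3) ℂ)) * (Z - s • (1 : Matrix (Fin 3) (Fin 3) ℂ)) *
        (Z - t • (1 : Matrix (Fin 3) (Fin 3) ℂ)) = 0 := by
  have hroot : ∀ r ∈ Z.charpoly.roots, r ^ n = c := by
    intro r hr
    have hdet : (r • (1 : Matrix (Fin 3) (Fin 3) ℂ) - Z).det = 0 := by
      have := (Polynomial.mem_roots'.1 hr).2
      rw [Polynomial.IsRoot, eval_charpoly] at this
      rwa [smul_one_eq_diagonal]
    obtain ⟨v, hv, hZ⟩ := exists_mulVec_eq_zero_iff.2 hdet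
    have hZv : Z *ᵥ v = r • v := by
      rw [sub_mulVec, smul_mulVec, one_mulVec, sub_eq_zero] at hZ
      exact hZ.symm
    have hpow : ∀ k : ℕ, Z ^ k *ᵥ v = r ^ k • v := by
      intro k
      induction k with
      | zero => simp
      | succ k ih => rw [pow_succ', ← mulVec_mulVec, ih, mulVec_smul, hZv, smul_smul, pow_succ]
    have := hpow n
    rw [h, smul_mulVec, one_mulVec] at this
    obtain ⟨i, hi⟩ := Function.ne_iff.1 hv
    exact (mul_right_cancel₀ hi (congrFun this i)).symm
  have hcard : Multiset.card Z.charpoly.roots = 3 := by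
    rw [IsAlgClosed.card_roots_eq_natDegree]
    simp
  obtain ⟨r, s, t, hrst⟩ := Multiset.card_eq_three.1 hcard
  have hprod : Z.charpoly =
      (Polynomial.X - Polynomial.C r) * (Polynomial.X - Polynomial.C s) *
        (Polynomial.X - Polynomial.C t) := by
    have := (IsAlgClosed.splits Z.charpoly).eq_prod_roots_of_monic Z.charpoly_monic
    rw [hrst] at this
    simpa [mul_assoc] using this
  refine ⟨r, s, t, hroot r (by simp [hrst]), hroot s (by simp [hrst]), hroot t (by simp [hrst]),
    ?_, ?_, ?_⟩
  · rw [det_eq_prod_roots_charpoly, hrst]; simp [mul_assoc]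
  · rw [trace_eq_sum_roots_charpoly, hrst]; simp [add_assoc]
  · have := aeval_self_charpoly Z
    rw [hprod] at this
    simpa [Algebra.algebraMap_eq_smul_one] using this

/-- With N = Z − r and N³ = 0, expanding Z⁴ = r⁴ leaves 4r³N + 6r²N² = 0. Multiplying by N gives N²
= 0, and then N = 0. -/
theorem eq_smul_one_of_pow_of_nilpotent {Z : Matrix (Fin 3) (Fin 3) ℂ} {r c : ℂ} (hr : r ≠ 0)
    (h : Z ^ 4 = c • (1 : Matrix (Fin 3) (Fin 3) ℂ)) (hrc : r ^ 4 = c)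
    (h3 : (Z - r • (1 : Matrix (Fin 3) (Fin 3) ℂ)) * (Z - r • (1 : Matrix (Fin 3) (Fin 3) ℂ)) *
      (Z - r • (1 : Matrix (Fin 3) (Fin 3) ℂ)) = 0) :
    Z = r • (1 : Matrix (Fin 3) (Fin 3) ℂ) := by
  obtain ⟨N, rfl⟩ : ∃ N, Z = N + r • (1 : Matrix (Fin 3) (Fin 3) ℂ) := ⟨Z - r • 1, by simp⟩
  rw [add_sub_cancel_right] at h3
  have h4 : (4 * r ^ 3) • N + (6 * r ^ 2) • (N * N) = 0 := by
    have e : (N + r • (1 : Matrix (Fin 3) (Fin 3) ℂ)) ^ 4 =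
        (N * N * N) * N + (4 * r) • (N * N * N) + (6 * r ^ 2) • (N * N) + (4 * r ^ 3) • N +
          (r ^ 4) • (1 : Matrix (Fin 3) (Fin 3) ℂ) := by
      simp only [pow_succ, pow_zero, one_mul, add_mul, mul_add, smul_mul_assoc, mul_smul_comm,
        mul_one, smul_add, smul_smul, mul_assoc]
      module
    rw [e, h3, hrc] at h
    have := sub_eq_zero.2 h
    rw [← this]
    simp only [zero_mul, smul_zero]
    abel
  have h5 : N * N = 0 := by
    have := congrArg (· * N) h4
    simp only [add_mul, smul_mul_assoc, h3, smul_zero, add_zero, zero_mul] at this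
    exact (smul_eq_zero.1 this).resolve_left (by simp [hr])
  rw [h5, smul_zero, add_zero] at h4
  rw [(smul_eq_zero.1 h4).resolve_left (by simp [hr]), zero_add]

theorem pow_four_eq_one {s : ℂ} (h : s ^ 4 = 1) :
    s = 1 ∨ s = -1 ∨ s = Complex.I ∨ s = -Complex.I := by
  have : (s - 1) * ((s + 1) * ((s - Complex.I) * (s + Complex.I))) = 0 := by
    linear_combination h - (s ^ 2 - 1) * Complex.I_sq
  rcases mul_eq_zero.1 this with h | h
  · exact Or.inl (sub_eq_zero.1 h)
  rcases mul_eq_zero.1 h with h | h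
  · exact Or.inr (Or.inl (eq_neg_of_add_eq_zero_left h))
  rcases mul_eq_zero.1 h with h | h
  · exact Or.inr (Or.inr (Or.inl (sub_eq_zero.1 h)))
  · exact Or.inr (Or.inr (Or.inr (eq_neg_of_add_eq_zero_left h)))

theorem sum_fourth_roots {r s t : ℂ} (hr : r ^ 4 = 1) (hs : s ^ 4 = 1) (ht : t ^ 4 = 1)
    (h : r * s * t = 1) : (r = 1 ∧ s = 1 ∧ t = 1) ∨
      (r + s + t = 1 ∨ r + s + t = -1 ∨ r + s + t = -1 + 2 * Complex.I ∨
        r + s + t = -1 - 2 * Complex.I) := by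
  have hrs : r * s ≠ 0 := by rintro h0; rw [h0, zero_mul] at h; exact zero_ne_one h
  have ht' : t = (r * s)⁻¹ := eq_inv_of_mul_eq_one_right h
  subst ht'
  rcases pow_four_eq_one hr with rfl | rfl | rfl | rfl <;>
    rcases pow_four_eq_one hs with rfl | rfl | rfl | rfl <;>
    norm_num [Complex.ext_iff]

/-- The possible traces of a matrix of determinant one whose fourth power is scalar. -/
theorem trace_pow_three_of_pow_four {Z : Matrix (Fin 3) (Fin 3) ℂ} {c : ℂ} (hdet : Z.det = 1)
    (h : Z ^ 4 = c • (1 : Matrix (Fin 3) (Fin 3) ℂ)) :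
    (∃ d : ℂ, Z = d • (1 : Matrix (Fin 3) (Fin 3) ℂ)) ∨
      (Z.trace ^ 3 = 1 ∨ Z.trace ^ 3 = -1 ∨ Z.trace ^ 3 = 11 + 2 * Complex.I ∨
        Z.trace ^ 3 = 11 - 2 * Complex.I) := by
  have hc : c ^ 3 = 1 := by
    have := congrArg det h
    rw [det_pow, hdet, one_pow, det_smul, det_one, Fintype.card_fin, mul_one] at this
    exact this.symm
  obtain ⟨r, s, t, hr, hs, ht, hd, htr, hZ⟩ := exists_eigenvalues Z h
  rw [hdet] at hd
  -- Since c³ = 1, multiplying by c² turns the eigenvalues into fourth roots of unity without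
  -- changing their product or the cube of the trace.
  have key : ∀ x : ℂ, x ^ 4 = c → (c ^ 2 * x) ^ 4 = 1 := by
    intro x hx
    rw [mul_pow, hx]
    linear_combination (c ^ 6 + c ^ 3 + 1) * hc
  have hprod : c ^ 2 * r * (c ^ 2 * s) * (c ^ 2 * t) = 1 := by
    linear_combination (-c ^ 6) * hd + (c ^ 3 + 1) * hc
  have htr3 : Z.trace ^ 3 = (c ^ 2 * r + c ^ 2 * s + c ^ 2 * t) ^ 3 := by
    rw [htr]; linear_combination (-(r + s + t) ^ 3 * (c ^ 3 + 1)) * hc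
  have hI := Complex.I_sq
  rcases sum_fourth_roots (key r hr) (key s hs) (key t ht) hprod with ⟨h1, h2, h3⟩ | h1
  · left
    have hc2 : c ^ 2 ≠ 0 := by rintro h0; rw [h0, zero_mul] at h1; exact zero_ne_one h1
    have hrs : s = r := mul_left_cancel₀ hc2 (h2.trans h1.symm)
    have hrt : t = r := mul_left_cancel₀ hc2 (h3.trans h1.symm)
    rw [hrs, hrt] at hZ
    have hr0 : r ≠ 0 := by rintro rfl; simp at h1
    exact ⟨r, eq_smul_one_of_pow_of_nilpotent hr0 h hr hZ⟩
  · right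
    rw [htr3]
    rcases h1 with h | h | h | h <;> rw [h]
    · left; norm_num
    · right; left; norm_num
    · right; right; right
      linear_combination (-12 + 8 * Complex.I) * hI
    · right; right; left
      linear_combination (-12 - 8 * Complex.I) * hI

namespace U21

/-- A scalar of modulus one normalises the determinant and leaves the modulus of the trace
unchanged; the cubes ±1 and 11 ± 2i have squared moduli 1 and 5³. -/
theorem trace_normSq_of_pow_four {g : U21} {c : ℂ}
    (h : mat g ^ 4 = c • (1 : Matrix (Fin 3) (Fin 3) ℂ)) :
    (∃ d : ℂ, mat g = d • (1 : Matrix (Fin 3) (Fin 3) ℂ)) ∨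
      (Complex.normSq (mat g).trace = 1 ∨ Complex.normSq (mat g).trace = 5) := by
  have hd := normSq_det g
  have hd0 : (mat g).det ≠ 0 := by intro h0; rw [h0] at hd; simp at hd
  obtain ⟨δ, hδ⟩ := IsAlgClosed.exists_pow_nat_eq (mat g).det⁻¹ (n := 3) (by norm_num)
  have hδ1 : Complex.normSq δ = 1 := by
    have := congrArg Complex.normSq hδ
    rw [map_pow, map_inv₀, hd, inv_one] at this
    exact (pow_eq_one_iff_of_nonneg (Complex.normSq_nonneg δ) (by norm_num)).1 this
  have hδ0 : δ ≠ 0 := by rintro rfl; simp at hδ1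
  have h1 : (δ • mat g).det = 1 := by
    rw [det_smul, Fintype.card_fin, hδ, inv_mul_cancel₀ hd0]
  have h4 : (δ • mat g) ^ 4 = (δ ^ 4 * c) • (1 : Matrix (Fin 3) (Fin 3) ℂ) := by
    rw [smul_pow, h, smul_smul]
  rcases trace_pow_three_of_pow_four h1 h4 with ⟨d, hd⟩ | h
  · left
    refine ⟨δ⁻¹ * d, ?_⟩
    rw [← smul_smul, ← hd, smul_smul, inv_mul_cancel₀ hδ0, one_smul]
  · right
    set w := (mat g).trace
    have hw : Complex.normSq w ^ 3 = Complex.normSq ((δ • mat g).trace ^ 3) := by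
      rw [trace_smul, smul_eq_mul, map_pow, map_mul, hδ1, one_mul]
    have h0 := Complex.normSq_nonneg w
    have : Complex.normSq w ^ 3 = 1 ^ 3 ∨ Complex.normSq w ^ 3 = 5 ^ 3 := by
      rw [hw]
      rcases h with h | h | h | h <;> rw [h] <;> norm_num [Complex.normSq_apply]
    rcases this with h | h
    · exact Or.inl ((pow_left_inj₀ h0 (by norm_num) (by norm_num)).1 h)
    · exact Or.inr ((pow_left_inj₀ h0 (by norm_num) (by norm_num)).1 h)

end U21

end CRTriangle

namespace CRTriangle

open Matrix ComplexConjugate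

/-! ### Cube roots of unity -/

theorem conj_of_normSq_eq_one {z : ℂ} (h : Complex.normSq z = 1) : conj z = z⁻¹ := by
  rw [Complex.inv_def, h]; simp

theorem normSq_of_pow_three_eq_one {z : ℂ} (h : z ^ 3 = 1) : Complex.normSq z = 1 := by
  have := congrArg Complex.normSq h
  rw [map_pow, map_one] at this
  exact (pow_eq_one_iff_of_nonneg (Complex.normSq_nonneg z) (by norm_num)).1 this

theorem pow_three_of_root {ζ : ℂ} (h : ζ ^ 2 + ζ + 1 = 0) : ζ ^ 3 = 1 := by
  linear_combination (ζ - 1) * h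

theorem conj_of_root {ζ : ℂ} (h : ζ ^ 2 + ζ + 1 = 0) : conj ζ = -1 - ζ := by
  have h3 := pow_three_of_root h
  rw [conj_of_normSq_eq_one (normSq_of_pow_three_eq_one h3)]
  have : ζ ≠ 0 := by rintro rfl; simp at h
  rw [inv_eq_iff_eq_inv, eq_comm, inv_eq_of_mul_eq_one_left]
  linear_combination -h

theorem root_ne_one {ζ : ℂ} (h : ζ ^ 2 + ζ + 1 = 0) : ζ - 1 ≠ 0 := by
  intro h1
  rw [sub_eq_zero.1 h1] at h
  norm_num at h

theorem root_eq_or {ζ ξ : ℂ} (h : ζ ^ 2 + ζ + 1 = 0) (h' : ξ ^ 2 + ξ + 1 = 0) :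
    ξ = ζ ∨ ξ = -1 - ζ := by
  have : (ξ - ζ) * (ξ - (-1 - ζ)) = 0 := by linear_combination h' - h
  rcases mul_eq_zero.1 this with h | h
  · exact Or.inl (sub_eq_zero.1 h)
  · exact Or.inr (sub_eq_zero.1 h)

/-- The cube root of unity `(-1 + i√3) / 2`. -/
noncomputable def cubeRoot : ℂ := ⟨-1 / 2, √3 / 2⟩

theorem cubeRoot_root : cubeRoot ^ 2 + cubeRoot + 1 = 0 := by
  have := Real.mul_self_sqrt (show (0 : ℝ) ≤ 3 by norm_num)
  apply Complex.ext
  · simp [cubeRoot, pow_two]; linarith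
  · simp [cubeRoot, pow_two]; ring

/-! ### Matrices of order three -/

/-- If γ is not an eigenvalue, A − γ can be cancelled from A³ − 1, leaving a quadratic with distinct
roots. Thus A is affine in an idempotent: scalar, or a multiple of a complex reflection of order
three. -/
theorem order_three_nonregular {A : Matrix (Fin 3) (Fin 3) ℂ} (hA : A ^ 3 = 1) {γ : ℂ}
    (hγ : γ ^ 3 = 1) (hdet : (A - γ • (1 : Matrix (Fin 3) (Fin 3) ℂ)).det ≠ 0) :
    (∃ d : ℂ, A = d • (1 : Matrix (Fin 3) (Fin 3) ℂ)) ∨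
      ∃ α ζ : ℂ, ∃ E, α ^ 3 = 1 ∧ ζ ^ 2 + ζ + 1 = 0 ∧ IsRankOneProj E ∧
        A = α • (1 + (ζ - 1) • E) := by
  have hω := cubeRoot_root
  set ω := cubeRoot
  have hω3 := pow_three_of_root hω
  have hγ0 : γ ≠ 0 := by rintro rfl; simp at hγ
  have hω0 : ω ≠ 0 := by intro h; rw [h] at hω; simp at hω
  have hω1 := root_ne_one hω
  have hfac : (A - γ • (1 : Matrix (Fin 3) (Fin 3) ℂ)) *
      ((A - (γ * ω) • (1 : Matrix (Fin 3) (Fin 3) ℂ)) *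
        (A - (γ * ω ^ 2) • (1 : Matrix (Fin 3) (Fin 3) ℂ))) = 0 := by
    have e : (A - γ • (1 : Matrix (Fin 3) (Fin 3) ℂ)) *
      ((A - (γ * ω) • (1 : Matrix (Fin 3) (Fin 3) ℂ)) *
        (A - (γ * ω ^ 2) • (1 : Matrix (Fin 3) (Fin 3) ℂ))) =
        A ^ 3 - (γ * (ω ^ 2 + ω + 1)) • (A * A) + (γ ^ 2 * ω * (ω ^ 2 + ω + 1)) • A -
          (γ ^ 3 * ω ^ 3) • (1 : Matrix (Fin 3) (Fin 3) ℂ) := by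
      simp only [pow_succ, pow_zero, one_mul, sub_mul, mul_sub, smul_mul_assoc, mul_smul_comm,
        mul_one, smul_sub, smul_smul, mul_assoc]
      module
    rw [e, hω, hA, hγ, hω3]
    simp
  have hquad : (A - (γ * ω) • (1 : Matrix (Fin 3) (Fin 3) ℂ)) *
        (A - (γ * ω ^ 2) • (1 : Matrix (Fin 3) (Fin 3) ℂ)) = 0 := by
    have := congrArg ((A - γ • (1 : Matrix (Fin 3) (Fin 3) ℂ))⁻¹ * ·) hfac
    simpa [nonsing_inv_mul_cancel_left _ _ (isUnit_iff_ne_zero.2 hdet)] using this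
  have hd : γ * ω ^ 2 - γ * ω ≠ 0 := by
    rw [show γ * ω ^ 2 - γ * ω = γ * ω * (ω - 1) by ring]
    exact mul_ne_zero (mul_ne_zero hγ0 hω0) hω1
  obtain ⟨E, hE⟩ : ∃ E, A = (γ * ω) • (1 : Matrix (Fin 3) (Fin 3) ℂ) +
      (γ * ω ^ 2 - γ * ω) • E :=
    ⟨(γ * ω ^ 2 - γ * ω)⁻¹ • (A - (γ * ω) • 1), by rw [smul_smul, mul_inv_cancel₀ hd]; simp⟩
  have hEE : E * E = E := by
    have e : (A - (γ * ω) • (1 : Matrix (Fin 3) (Fin 3) ℂ)) *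
        (A - (γ * ω ^ 2) • (1 : Matrix (Fin 3) (Fin 3) ℂ)) =
        (γ * ω ^ 2 - γ * ω) ^ 2 • (E * E - E) := by
      rw [hE]
      simp only [sub_mul, mul_sub, add_mul, mul_add, smul_mul_assoc, mul_smul_comm,
        mul_one, one_mul, smul_sub, smul_add, smul_smul]
      module
    rw [e, smul_eq_zero] at hquad
    exact sub_eq_zero.1 (hquad.resolve_left (pow_ne_zero 2 hd))
  rcases idempotent_cases hEE with rfl | rfl | h | h
  · exact Or.inl ⟨γ * ω, by simpa using hE⟩
  · refine Or.inl ⟨γ * ω ^ 2, ?_⟩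
    rw [hE]; module
  · refine Or.inr ⟨γ * ω, ω, E, by rw [mul_pow, hγ, hω3, one_mul], hω, h, ?_⟩
    rw [hE]; module
  -- When E has rank two, the simple eigenvalue is γω, on the image of 1 − E, and γω = γω²·ω².
  · refine Or.inr ⟨γ * ω ^ 2, ω ^ 2, 1 - E, ?_, ?_, h, ?_⟩
    · rw [mul_pow, hγ]; linear_combination (ω ^ 3 + 1) * hω3
    · linear_combination hω + ω * hω3
    · rw [hE]
      have e : γ * ω = γ * ω ^ 2 * ω ^ 2 := by linear_combination (-γ * ω) * hω3
      rw [e]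
      module

/-- The diagonal matrix with the three cube roots of unity. -/
noncomputable def cubeDiag : Matrix (Fin 3) (Fin 3) ℂ := diagonal ![1, cubeRoot, cubeRoot ^ 2]

theorem order_three_regular {A : Matrix (Fin 3) (Fin 3) ℂ}
    (h : ∀ γ : ℂ, γ ^ 3 = 1 → (A - γ • (1 : Matrix (Fin 3) (Fin 3) ℂ)).det = 0) :
    ∃ P : Matrix (Fin 3) (Fin 3) ℂ, P.det ≠ 0 ∧ A * P = P * cubeDiag := by
  have hω := cubeRoot_root
  have hω3 := pow_three_of_root hω
  have hω1 := root_ne_one hω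
  have hω0 : cubeRoot ≠ 0 := by intro h; rw [h] at hω; simp at hω
  let μ : Fin 3 → ℂ := ![1, cubeRoot, cubeRoot ^ 2]
  have hμ : ∀ i, μ i ^ 3 = 1 := by
    intro i
    fin_cases i
    · simp [μ]
    · exact hω3
    · change (cubeRoot ^ 2) ^ 3 = 1
      linear_combination (cubeRoot ^ 3 + 1) * hω3
  have hinj : Function.Injective μ := by
    have h1 : cubeRoot ≠ 1 := sub_ne_zero.1 hω1
    have h2 : cubeRoot ^ 2 ≠ 1 := by
      intro h2
      apply h1
      linear_combination hω3 - cubeRoot * h2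
    have h3 : cubeRoot ≠ cubeRoot ^ 2 := by
      intro h3
      apply h1
      have : cubeRoot * (cubeRoot - 1) = 0 := by linear_combination -h3
      exact absurd this (mul_ne_zero hω0 hω1)
    intro i j hij
    fin_cases i <;> fin_cases j <;> simp [μ, h1, h2, h3, h1.symm, h2.symm, h3.symm] at hij ⊢
  have hv : ∀ i, ∃ v : Fin 3 → ℂ, v ≠ 0 ∧ A *ᵥ v = μ i • v := by
    intro i
    obtain ⟨v, hv, hA⟩ := exists_mulVec_eq_zero_iff.2 (h (μ i) (hμ i))
    refine ⟨v, hv, ?_⟩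
    rwa [sub_mulVec, smul_mulVec, one_mulVec, sub_eq_zero] at hA
  choose f hf0 hf using hv
  have hli : LinearIndependent ℂ f :=
    Module.End.eigenvectors_linearIndependent' (toLin' A) μ hinj f fun i =>
      ⟨Module.End.mem_eigenspace_iff.2 (by rw [toLin'_apply, hf]), hf0 i⟩
  refine ⟨(Matrix.of f)ᵀ, ?_, ?_⟩
  · rw [det_transpose]
    exact ((Matrix.isUnit_iff_isUnit_det _).1
      (linearIndependent_rows_iff_isUnit.1 (by exact hli))).ne_zero
  · ext i j
    have := congrFun (hf j) i
    rw [cubeDiag, mul_diagonal]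
    simp only [mulVec, dotProduct, Pi.smul_apply, smul_eq_mul] at this
    rw [Matrix.mul_apply]
    simp only [transpose_apply, of_apply]
    rw [this, mul_comm]

theorem trace_and_det_of_regular {A P : Matrix (Fin 3) (Fin 3) ℂ} (hP : P.det ≠ 0)
    (h : A * P = P * cubeDiag) : A.trace = 0 ∧ A.det = 1 := by
  have hu := isUnit_iff_ne_zero.2 hP
  have hA : A = P * cubeDiag * P⁻¹ := by
    rw [← h, mul_nonsing_inv_cancel_right _ _ hu]
  constructor
  · rw [hA, trace_mul_comm, nonsing_inv_mul_cancel_left _ _ hu, cubeDiag, trace_diagonal,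
      Fin.sum_univ_three]
    simp only [cons_val]
    linear_combination cubeRoot_root
  · have := congrArg det h
    rw [det_mul, det_mul, mul_comm] at this
    rw [mul_left_cancel₀ hP this, cubeDiag, det_diagonal, Fin.prod_univ_three]
    simpa [pow_succ, mul_assoc] using pow_three_of_root cubeRoot_root

/-! ### Pairs of elements of order three with unipotent commutator -/

open U21

/-- Lifts of a representation of the triangle group with unipotent commutator. -/
structure CommPair (X Y : U21) : Prop where
  pow_X : mat X ^ 3 = 1
  pow_Y : mat Y ^ 3 = 1
  pow_XY : ∃ c : ℂ, mat (X * Y) ^ 4 = c • (1 : Matrix (Fin 3) (Fin 3) ℂ)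
  trace_comm : ∃ c : ℂ, c ^ 3 = 1 ∧ (mat (X * Y * X⁻¹ * Y⁻¹)).trace = 3 * c
  not_commute : X * Y ≠ Y * X

namespace CommPair

variable {X Y : U21}

theorem symm (h : CommPair X Y) : CommPair Y X where
  pow_X := h.pow_Y
  pow_Y := h.pow_X
  pow_XY := by
    obtain ⟨c, hc⟩ := h.pow_XY
    refine ⟨c, ?_⟩
    rw [← mat_pow] at hc ⊢
    have e : (Y * X) ^ 4 = X⁻¹ * (X * Y) ^ 4 * X := by
      simp only [pow_succ, pow_zero, one_mul, mul_assoc, inv_mul_cancel_left]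
    rw [e, mat_mul, mat_mul, hc, mul_smul_comm, mul_one, smul_mul_assoc, mat_inv_mul_mat]
  trace_comm := by
    obtain ⟨c, hc, h⟩ := h.trace_comm
    refine ⟨conj c, by rw [← map_pow, hc, map_one], ?_⟩
    have e : Y * X * Y⁻¹ * X⁻¹ = (X * Y * X⁻¹ * Y⁻¹)⁻¹ := by group
    rw [e, trace_mat_inv, h, map_mul, map_ofNat]
  not_commute := h.not_commute.symm

/-- YX is conjugate to XY, so the two would coincide if XY were scalar. -/
theorem not_scalar (h : CommPair X Y) :
    ¬ ∃ d : ℂ, mat (X * Y) = d • (1 : Matrix (Fin 3) (Fin 3) ℂ) := by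
  rintro ⟨d, hd⟩
  apply h.not_commute
  apply mat_injective
  have e : Y * X = X⁻¹ * (X * Y) * X := by group
  rw [e, mat_mul (X⁻¹ * (X * Y)), mat_mul X⁻¹, hd, mul_smul_comm, mul_one, smul_mul_assoc,
    mat_inv_mul_mat]

theorem not_scalar_right (h : CommPair X Y) :
    ¬ ∃ d : ℂ, mat Y = d • (1 : Matrix (Fin 3) (Fin 3) ℂ) := by
  rintro ⟨d, hd⟩
  apply h.not_commute
  apply mat_injective
  rw [mat_mul, mat_mul, hd, mul_smul_comm, mul_one, smul_mul_assoc, one_mul]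

theorem normSq_trace (h : CommPair X Y) :
    Complex.normSq (mat (X * Y)).trace = 1 ∨ Complex.normSq (mat (X * Y)).trace = 5 := by
  obtain ⟨c, hc⟩ := h.pow_XY
  exact (trace_normSq_of_pow_four hc).resolve_left h.not_scalar

end CommPair

section Nonregular

variable {X Y : U21} {α ζ : ℂ} {E : Matrix (Fin 3) (Fin 3) ℂ}

/-- Here −2 − ζ is ζ̄ − 1: inverting replaces α and ζ by their conjugates. -/
theorem mat_inv_of_rankOne (hα : α ^ 3 = 1) (hζ : ζ ^ 2 + ζ + 1 = 0) (hE : IsRankOneProj E)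
    (hY : mat Y = α • (1 + (ζ - 1) • E)) :
    mat Y⁻¹ = conj α • (1 + (-2 - ζ) • E) := by
  have hα0 : α ≠ 0 := by rintro rfl; simp at hα
  have h : mat Y * (conj α • (1 + (-2 - ζ) • E)) = 1 := by
    rw [hY, smul_mul_smul_comm, conj_of_normSq_eq_one (normSq_of_pow_three_eq_one hα),
      mul_inv_cancel₀ hα0, one_smul]
    have : (ζ - 1) * (-2 - ζ) = 3 - (ζ ^ 2 + ζ + 1) := by ring
    simp only [add_mul, mul_add, smul_mul_assoc, mul_smul_comm, mul_one, one_mul, hE.mul_self,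
      smul_add, smul_smul, mul_comm (-2 - ζ), this, hζ]
    module
  calc mat Y⁻¹ = mat Y⁻¹ * (mat Y * (conj α • (1 + (-2 - ζ) • E))) := by rw [h, mul_one]
    _ = _ := by rw [← mul_assoc, mat_inv_mul_mat, one_mul]

theorem trace_mul_of_rankOne (hY : mat Y = α • (1 + (ζ - 1) • E)) :
    (mat (X * Y)).trace = α * ((mat X).trace + (ζ - 1) * (mat X * E).trace) := by
  rw [mat_mul, hY]
  simp [mul_add, trace_add, trace_smul]

/-- Expand tr (XY)⁻¹ = conj tr XY: the terms without E already agree, and the coefficient of the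
remaining ones is nonzero. -/
theorem trace_inv_mul_of_rankOne (hα : α ^ 3 = 1) (hζ : ζ ^ 2 + ζ + 1 = 0)
    (hE : IsRankOneProj E) (hY : mat Y = α • (1 + (ζ - 1) • E)) :
    (mat X⁻¹ * E).trace = conj (mat X * E).trace := by
  have h := trace_mat_inv (X * Y)
  rw [_root_.mul_inv_rev, mat_mul, trace_mul_comm, mat_inv_of_rankOne hα hζ hE hY,
    trace_mul_of_rankOne hY, map_mul] at h
  simp only [mul_smul_comm, mul_add, mul_one, trace_smul, trace_add, smul_eq_mul, map_add, map_mul,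
    map_sub, map_one, conj_of_root hζ, trace_mat_inv] at h
  have hα0 : conj α ≠ 0 := by
    intro h0; rw [map_eq_zero] at h0; rw [h0] at hα; simp at hα
  have hz : (-2 - ζ) ≠ 0 := by
    intro h0
    have : ζ = -2 := by linear_combination -h0
    rw [this] at hζ
    norm_num at hζ
  exact mul_left_cancel₀ (mul_ne_zero hα0 hz) (by linear_combination h)

/-- In the expansion of the commutator, EX⁻¹E = tr(X⁻¹E)·E produces |tr(XE)|² with coefficient (ζ −
1)(ζ̄ − 1) = 3, while the other terms sum to 3 + (ζ − 1) + (ζ̄ − 1) = 0. -/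
theorem trace_comm_of_rankOne (hα : α ^ 3 = 1) (hζ : ζ ^ 2 + ζ + 1 = 0)
    (hE : IsRankOneProj E) (hY : mat Y = α • (1 + (ζ - 1) • E)) :
    (mat (X * Y * X⁻¹ * Y⁻¹)).trace = 3 * Complex.normSq (mat X * E).trace := by
  have hα0 : α ≠ 0 := by rintro rfl; simp at hα
  have hαα : α * conj α = 1 := by
    rw [conj_of_normSq_eq_one (normSq_of_pow_three_eq_one hα), mul_inv_cancel₀ hα0]
  rw [Complex.normSq_eq_conj_mul_self, ← trace_inv_mul_of_rankOne hα hζ hE hY, mat_mul, mat_mul,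
    mat_mul, mat_inv_of_rankOne hα hζ hE hY, hY]
  have e : mat X * α • (1 + (ζ - 1) • E) * mat X⁻¹ * conj α • (1 + (-2 - ζ) • E) =
      (α * conj α) • (1 + (-2 - ζ) • E + (ζ - 1) • (mat X * (E * mat X⁻¹)) +
        ((ζ - 1) * (-2 - ζ)) • (mat X * (E * mat X⁻¹ * E))) := by
    have e1 := mat_mul_mat_inv X
    simp only [mul_add, add_mul, smul_mul_assoc, mul_smul_comm, mul_one, smul_add,
      smul_smul, mul_assoc]
    rw [← mul_assoc (mat X) (mat X⁻¹) E, e1, one_mul]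
    module
  rw [e, hαα, one_smul, hE.mul_mul]
  simp only [trace_add, trace_smul, trace_one, hE.trace, smul_eq_mul, mul_smul_comm]
  rw [trace_mul_comm (mat X) (E * mat X⁻¹), Matrix.mul_assoc, mat_inv_mul_mat,
    Matrix.mul_one, hE.trace, Fintype.card_fin]
  push_cast
  linear_combination (-(mat X⁻¹ * E).trace * (mat X * E).trace) * hζ

/-- By the trace formula this nonnegative real number is a cube root of unity, hence 1. -/
theorem CommPair.normSq_trace_rankOne (h : CommPair X Y) (hα : α ^ 3 = 1)
    (hζ : ζ ^ 2 + ζ + 1 = 0) (hE : IsRankOneProj E) (hY : mat Y = α • (1 + (ζ - 1) • E)) :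
    Complex.normSq (mat X * E).trace = 1 := by
  obtain ⟨c, hc, ht⟩ := h.trace_comm
  rw [trace_comm_of_rankOne hα hζ hE hY] at ht
  have hc' : c = (Complex.normSq (mat X * E).trace : ℂ) := by linear_combination -ht / 3
  rw [hc'] at hc
  exact (pow_eq_one_iff_of_nonneg (Complex.normSq_nonneg _) (by norm_num)).1
    (show Complex.normSq (mat X * E).trace ^ 3 = 1 by exact_mod_cast hc)

end Nonregular

theorem normSq_eq_of_mul_conj {z : ℂ} {r : ℝ} (h : z * conj z = r) : Complex.normSq z = r := by
  rw [Complex.mul_conj] at h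
  exact_mod_cast h

/-- Both members of a pair have three distinct eigenvalues. -/
theorem CommPair.regular {X Y : U21} (h : CommPair X Y) {γ : ℂ} (hγ : γ ^ 3 = 1) :
    (mat Y - γ • (1 : Matrix (Fin 3) (Fin 3) ℂ)).det = 0 := by
  by_contra hdet
  obtain ⟨α, ζ, E, hα, hζ, hE, hY⟩ :=
    (order_three_nonregular h.pow_Y hγ hdet).resolve_left h.not_scalar_right
  have hu := h.normSq_trace_rankOne hα hζ hE hY
  have hw := h.normSq_trace
  rw [trace_mul_of_rankOne hY, map_mul, normSq_of_pow_three_eq_one hα, one_mul] at hw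
  have hζc := conj_of_root hζ
  -- If X has all three eigenvalues, tr X = 0 and |tr XY|² = |ζ − 1|² = 3, which is neither 1 nor 5.
  -- Otherwise X is a multiple of a reflection too, and everything depends on τ = tr(FE).
  by_cases hX : ∀ γ : ℂ, γ ^ 3 = 1 → (mat X - γ • (1 : Matrix (Fin 3) (Fin 3) ℂ)).det = 0
  · obtain ⟨P, hP, hXP⟩ := order_three_regular hX
    rw [(trace_and_det_of_regular hP hXP).1, zero_add, map_mul, hu, mul_one] at hw
    have : Complex.normSq (ζ - 1) = 3 := by
      apply normSq_eq_of_mul_conj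
      rw [map_sub, hζc, map_one]
      push_cast
      linear_combination -hζ
    rw [this] at hw
    norm_num at hw
  · push Not at hX
    obtain ⟨γ', hγ', hdet'⟩ := hX
    obtain ⟨β, ξ, F, hβ, hξ, hF, hXF⟩ :=
      (order_three_nonregular h.pow_X hγ' hdet').resolve_left h.symm.not_scalar_right
    have hξc := conj_of_root hξ
    have hβ0 : conj β ≠ 0 := by
      intro h0; rw [map_eq_zero] at h0; rw [h0] at hβ; simp at hβ
    have hβ1 := normSq_of_pow_three_eq_one hβ
    set τ := (F * E).trace with hτ
    have htX : (mat X).trace = β * (2 + ξ) := by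
      rw [hXF]
      simp only [trace_smul, trace_add, trace_one, hF.trace, smul_eq_mul, Fintype.card_fin]
      push_cast; ring
    have hXE : (mat X * E).trace = β * (1 + (ξ - 1) * τ) := by
      rw [hXF]
      simp [add_mul, trace_add, trace_smul, hE.trace, hτ, mul_add]
    have hXE' : (mat X⁻¹ * E).trace = conj β * (1 + (-2 - ξ) * τ) := by
      rw [mat_inv_of_rankOne hβ hξ hF hXF]
      simp [add_mul, trace_add, trace_smul, hE.trace, hτ, mul_add]
    have hreal : conj τ = τ := by
      have := trace_inv_mul_of_rankOne (X := X) hα hζ hE hY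
      rw [hXE, hXE', map_mul] at this
      have := mul_left_cancel₀ hβ0 this
      simp only [map_add, map_mul, map_sub, map_one, hξc] at this
      have hz : (-2 - ξ) ≠ 0 := by
        intro h0
        have : ξ = -2 := by linear_combination -h0
        rw [this] at hξ
        norm_num at hξ
      exact mul_left_cancel₀ hz (by linear_combination -this)
    -- For real τ, |1 + (ξ − 1)τ|² = 1 − 3τ + 3τ², so the condition is τ(τ − 1) = 0.
    have hτ01 : τ = 0 ∨ τ = 1 := by
      rw [hXE, map_mul, hβ1, one_mul] at hu
      have : ((Complex.normSq (1 + (ξ - 1) * τ) : ℝ) : ℂ) = 1 := by rw [hu]; norm_num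
      rw [Complex.normSq_eq_conj_mul_self] at this
      simp only [map_add, map_mul, map_sub, map_one, hξc, hreal] at this
      have h0 : τ * (τ - 1) = 0 := by linear_combination this / 3 + τ ^ 2 * hξ / 3
      rcases mul_eq_zero.1 h0 with h | h
      · exact Or.inl h
      · exact Or.inr (sub_eq_zero.1 h)
    have hsum : (mat X).trace + (ζ - 1) * (mat X * E).trace =
        β * (2 + ξ + (ζ - 1) * (1 + (ξ - 1) * τ)) := by
      rw [htX, hXE]; ring
    rw [hsum, map_mul, hβ1, one_mul] at hw
    have hval : Complex.normSq (2 + ξ + (ζ - 1) * (1 + (ξ - 1) * τ)) = 3 ∨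
        Complex.normSq (2 + ξ + (ζ - 1) * (1 + (ξ - 1) * τ)) = 0 ∨
        Complex.normSq (2 + ξ + (ζ - 1) * (1 + (ξ - 1) * τ)) = 9 := by
      rcases hτ01 with h0 | h0 <;> rw [h0] <;> rcases root_eq_or hζ hξ with h1 | h1 <;> rw [h1]
      · left
        apply normSq_eq_of_mul_conj
        simp only [map_add, map_mul, map_sub, map_one, map_ofNat, map_zero, hζc]
        push_cast
        linear_combination (-4) * hζ
      · right; left
        apply normSq_eq_of_mul_conj
        simp only [map_add, map_mul, map_sub, map_one, map_ofNat, map_zero, map_neg, hζc]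
        push_cast
        ring
      · left
        apply normSq_eq_of_mul_conj
        simp only [map_add, map_mul, map_sub, map_one, map_ofNat, hζc]
        push_cast
        linear_combination (ζ ^ 2 + ζ + 3) * hζ
      · right; right
        apply normSq_eq_of_mul_conj
        simp only [map_add, map_mul, map_sub, map_one, map_ofNat, map_neg, hζc]
        push_cast
        linear_combination (ζ ^ 2 + ζ - 5) * hζ
    rcases hval with h | h | h <;> rw [h] at hw <;> norm_num at hw

end CRTriangle

namespace CRTriangle

open Matrix ComplexConjugate U21

/-! ### Pairs in an eigenbasis of the first element -/

theorem trace_eq_of_mul_eq_mul {A B P : Matrix (Fin 3) (Fin 3) ℂ} (hP : P.det ≠ 0)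
    (h : A * P = P * B) : A.trace = B.trace := by
  have hu := isUnit_iff_ne_zero.2 hP
  rw [← mul_nonsing_inv_cancel_right P A hu, h, trace_mul_comm,
    nonsing_inv_mul_cancel_left _ _ hu]

theorem det_eq_of_mul_eq_mul {A B P : Matrix (Fin 3) (Fin 3) ℂ} (hP : P.det ≠ 0)
    (h : A * P = P * B) : A.det = B.det := by
  have := congrArg det h
  rw [det_mul, det_mul, mul_comm] at this
  exact mul_left_cancel₀ hP this

/-- An eigenbasis of `X`, given by the columns of `P`, in which `Y` and `Y⁻¹` have matrices `M` and
`N`; the columns are orthogonal with squared norms `h i`. -/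
structure EigenBasis (X Y : U21) (P M N : Matrix (Fin 3) (Fin 3) ℂ) (h : Fin 3 → ℝ) : Prop where
  det_ne_zero : P.det ≠ 0
  mul_X : mat X * P = P * cubeDiag
  mul_Y : mat Y * P = P * M
  mul_Y_inv : mat Y⁻¹ * P = P * N
  norm_ne_zero : ∀ i, h i ≠ 0
  gram_eq : Pᴴ * U21.gram * P = diagonal fun i => (h i : ℂ)
  adjoint : ∀ i j, conj (M j i) * h j = h i * N i j

/-- The inverse of `cubeDiag`. -/
noncomputable def cubeDiagInv : Matrix (Fin 3) (Fin 3) ℂ := diagonal ![1, cubeRoot ^ 2, cubeRoot]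

theorem cubeDiag_mul_inv : cubeDiag * cubeDiagInv = 1 := by
  have h := pow_three_of_root cubeRoot_root
  rw [cubeDiag, cubeDiagInv, diagonal_mul_diagonal, ← diagonal_one]
  congr 1
  ext i
  fin_cases i
  · simp
  · change cubeRoot * cubeRoot ^ 2 = 1
    linear_combination h
  · change cubeRoot ^ 2 * cubeRoot = 1
    linear_combination h

theorem conjTranspose_cubeDiag : cubeDiagᴴ = cubeDiagInv := by
  have h := conj_of_root cubeRoot_root
  rw [cubeDiag, cubeDiagInv, diagonal_conjTranspose]
  congr 1
  ext i
  fin_cases i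
  · simp
  · change conj cubeRoot = cubeRoot ^ 2
    rw [h]; linear_combination -cubeRoot_root
  · change conj (cubeRoot ^ 2) = cubeRoot
    rw [map_pow, h]; linear_combination cubeRoot_root

theorem CommPair.exists_eigenBasis {X Y : U21} (h : CommPair X Y) :
    ∃ P M N h, EigenBasis X Y P M N h := by
  obtain ⟨P, hP, hXP⟩ := order_three_regular fun γ hγ => h.symm.regular hγ
  have hu := isUnit_iff_ne_zero.2 hP
  have hω := cubeRoot_root
  have hω1 := root_ne_one hω
  have hω0 : cubeRoot ≠ 0 := by intro h; rw [h] at hω; simp at hω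
  set H := Pᴴ * U21.gram * P with hH
  have hHD : cubeDiagInv * H * cubeDiag = H := by
    have e : (mat X * P)ᴴ * U21.gram * (mat X * P) = H := by
      calc (mat X * P)ᴴ * U21.gram * (mat X * P) =
            Pᴴ * ((mat X)ᴴ * U21.gram * mat X) * P := by
              rw [conjTranspose_mul]; simp only [mul_assoc]
        _ = H := by rw [conjTranspose_mul_gram_mul]
    rw [hXP, conjTranspose_mul, conjTranspose_cubeDiag] at e
    calc cubeDiagInv * H * cubeDiag = cubeDiagInv * Pᴴ * U21.gram * (P * cubeDiag) := by
          rw [hH]; simp only [mul_assoc]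
      _ = H := e
  have hent : ∀ i j, cubeDiagInv i i * H i j * cubeDiag j j = H i j := by
    intro i j
    have := congrFun (congrFun hHD i) j
    have e : (cubeDiagInv * H * cubeDiag) i j = cubeDiagInv i i * H i j * cubeDiag j j := by
      rw [cubeDiag, cubeDiagInv, mul_diagonal, diagonal_mul, diagonal_apply_eq, diagonal_apply_eq]
    rwa [e] at this
  have hherm : ∀ i j, conj (H i j) = H j i := by
    have : Hᴴ = H := by
      have hg : U21.gramᴴ = U21.gram := by
        rw [U21.gram, diagonal_conjTranspose]
        congr 1; ext i; fin_cases i <;> simp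
      rw [hH, conjTranspose_mul, conjTranspose_mul, conjTranspose_conjTranspose, hg, mul_assoc]
    intro i j
    exact congrFun (congrFun this j) i
  -- Eigenvectors of a unitary map with distinct eigenvalues of modulus one are orthogonal.
  have hoff : ∀ i j, cubeDiagInv i i * cubeDiag j j ≠ 1 → H i j = 0 := by
    intro i j hij
    have := hent i j
    have : (cubeDiagInv i i * cubeDiag j j - 1) * H i j = 0 := by linear_combination this
    exact (mul_eq_zero.1 this).resolve_left (sub_ne_zero.2 hij)
  have hω1' : cubeRoot ≠ 1 := sub_ne_zero.1 hω1
  have hω2 : cubeRoot ^ 2 ≠ 1 := by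
    intro h2
    apply hω1'
    linear_combination pow_three_of_root hω - cubeRoot * h2
  have h01 : H 0 1 = 0 := hoff 0 1 (by simpa [cubeDiag, cubeDiagInv] using hω1')
  have h02 : H 0 2 = 0 := hoff 0 2 (by simpa [cubeDiag, cubeDiagInv] using hω2)
  have h12 : H 1 2 = 0 := hoff 1 2 (by
    have e : cubeRoot ^ 2 * cubeRoot ^ 2 = cubeRoot := by
      linear_combination cubeRoot * pow_three_of_root hω
    simpa [cubeDiag, cubeDiagInv, e] using hω1')
  have h10 : H 1 0 = 0 := by rw [← hherm, h01, map_zero]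
  have h20 : H 2 0 = 0 := by rw [← hherm, h02, map_zero]
  have h21 : H 2 1 = 0 := by rw [← hherm, h12, map_zero]
  have hre : ∀ i, ((H i i).re : ℂ) = H i i := fun i => Complex.conj_eq_iff_re.1 (hherm i i)
  have hdiag : H = diagonal fun i => ((H i i).re : ℂ) := by
    ext i j
    rw [diagonal_apply]
    split_ifs with hij
    · rw [hre, hij]
    · fin_cases i <;> fin_cases j <;> first | exact absurd rfl hij | assumption
  have hdet : H.det ≠ 0 := by
    rw [hH, det_mul, det_mul, det_conjTranspose, det_gram]
    simpa using hP
  have hne : ∀ i, (H i i).re ≠ 0 := by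
    rw [hdiag, det_diagonal] at hdet
    intro i
    have := Finset.prod_ne_zero_iff.1 hdet i (Finset.mem_univ i)
    exact_mod_cast this
  refine ⟨P, P⁻¹ * mat Y * P, P⁻¹ * mat Y⁻¹ * P, fun i => (H i i).re, hP, hXP, ?_, ?_, hne,
    hdiag, ?_⟩
  · rw [mul_assoc, mul_nonsing_inv_cancel_left _ _ hu]
  · rw [mul_assoc, mul_nonsing_inv_cancel_left _ _ hu]
  · intro i j
    have e : (P⁻¹ * mat Y * P)ᴴ * H = H * (P⁻¹ * mat Y⁻¹ * P) := by
      have e1 : P * (P⁻¹ * mat Y * P) = mat Y * P := by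
        rw [mul_assoc, mul_nonsing_inv_cancel_left _ _ hu]
      have e2 : P * (P⁻¹ * mat Y⁻¹ * P) = mat Y⁻¹ * P := by
        rw [mul_assoc, mul_nonsing_inv_cancel_left _ _ hu]
      have e3 : (mat Y)ᴴ * U21.gram = U21.gram * mat Y⁻¹ := by
        calc (mat Y)ᴴ * U21.gram = (mat Y)ᴴ * U21.gram * mat Y * mat Y⁻¹ := by
              rw [mul_assoc _ (mat Y), mat_mul_mat_inv, mul_one]
          _ = _ := by rw [conjTranspose_mul_gram_mul]
      calc (P⁻¹ * mat Y * P)ᴴ * H = (P * (P⁻¹ * mat Y * P))ᴴ * U21.gram * P := by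
            rw [conjTranspose_mul P, hH]; simp only [mul_assoc]
        _ = Pᴴ * ((mat Y)ᴴ * U21.gram) * P := by
            rw [e1, conjTranspose_mul]; simp only [mul_assoc]
        _ = Pᴴ * U21.gram * (P * (P⁻¹ * mat Y⁻¹ * P)) := by
            rw [e3, e2]; simp only [mul_assoc]
        _ = _ := by rw [hH]; simp only [mul_assoc]
    rw [hdiag] at e
    have := congrFun (congrFun e i) j
    rw [mul_diagonal, diagonal_mul] at this
    exact this

namespace EigenBasis

variable {X Y : U21} {P M N : Matrix (Fin 3) (Fin 3) ℂ} {h : Fin 3 → ℝ}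

theorem mul_X_inv (b : EigenBasis X Y P M N h) : mat X⁻¹ * P = P * cubeDiagInv := by
  calc mat X⁻¹ * P = mat X⁻¹ * (P * (cubeDiag * cubeDiagInv)) := by
        rw [cubeDiag_mul_inv, mul_one]
    _ = mat X⁻¹ * (mat X * P) * cubeDiagInv := by rw [b.mul_X]; simp only [mul_assoc]
    _ = _ := by rw [← mul_assoc (mat X⁻¹), mat_inv_mul_mat, one_mul]

theorem mul_inv (b : EigenBasis X Y P M N h) : M * N = 1 := by
  have hu := isUnit_iff_ne_zero.2 b.det_ne_zero
  have : P * (M * N) = P * 1 := by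
    rw [← mul_assoc, ← b.mul_Y, mul_assoc, ← b.mul_Y_inv, ← mul_assoc, mat_mul_mat_inv, one_mul,
      mul_one]
  have := congrArg (P⁻¹ * ·) this
  simpa only [nonsing_inv_mul_cancel_left _ _ hu] using this

theorem trace_Y (b : EigenBasis X Y P M N h) : (mat Y).trace = M 0 0 + M 1 1 + M 2 2 := by
  rw [trace_eq_of_mul_eq_mul b.det_ne_zero b.mul_Y, trace_fin_three]

theorem trace_Y_inv (b : EigenBasis X Y P M N h) :
    (mat Y⁻¹).trace = N 0 0 + N 1 1 + N 2 2 := by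
  rw [trace_eq_of_mul_eq_mul b.det_ne_zero b.mul_Y_inv, trace_fin_three]

theorem trace_XY (b : EigenBasis X Y P M N h) :
    (mat (X * Y)).trace = M 0 0 + cubeRoot * M 1 1 + cubeRoot ^ 2 * M 2 2 := by
  rw [mat_mul, trace_eq_of_mul_eq_mul (B := cubeDiag * M) b.det_ne_zero
    (by rw [mul_assoc, b.mul_Y, ← mul_assoc, b.mul_X, mul_assoc]), trace_fin_three, cubeDiag]
  simp [diagonal_mul]

theorem trace_XY_inv (b : EigenBasis X Y P M N h) :
    (mat (X * Y⁻¹)).trace = N 0 0 + cubeRoot * N 1 1 + cubeRoot ^ 2 * N 2 2 := by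
  rw [mat_mul, trace_eq_of_mul_eq_mul (B := cubeDiag * N) b.det_ne_zero
    (by rw [mul_assoc, b.mul_Y_inv, ← mul_assoc, b.mul_X, mul_assoc]), trace_fin_three, cubeDiag]
  simp [diagonal_mul]

/-- The traces of Y, XY and X⁻¹Y form the discrete Fourier transform of the diagonal of M; those of
the inverses do the same for N. -/
theorem trace_X_inv_Y (b : EigenBasis X Y P M N h) :
    conj (mat (X * Y⁻¹)).trace = M 0 0 + cubeRoot ^ 2 * M 1 1 + cubeRoot * M 2 2 := by
  rw [← trace_mat_inv, _root_.mul_inv_rev, inv_inv, mat_mul, trace_mul_comm,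
    trace_eq_of_mul_eq_mul (B := cubeDiagInv * M) b.det_ne_zero
    (by rw [mul_assoc, b.mul_Y, ← mul_assoc, b.mul_X_inv, mul_assoc]), trace_fin_three,
    cubeDiagInv]
  simp [diagonal_mul]

theorem trace_X_inv_Y_inv (b : EigenBasis X Y P M N h) :
    conj (mat (X * Y)).trace = N 0 0 + cubeRoot ^ 2 * N 1 1 + cubeRoot * N 2 2 := by
  rw [← trace_mat_inv, _root_.mul_inv_rev, mat_mul, trace_mul_comm,
    trace_eq_of_mul_eq_mul (B := cubeDiagInv * N) b.det_ne_zero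
    (by rw [mul_assoc, b.mul_Y_inv, ← mul_assoc, b.mul_X_inv, mul_assoc]), trace_fin_three,
    cubeDiagInv]
  simp [diagonal_mul]

/-- Each product M_ij N_ji carries the eigenvalue quotient λ_i/λ_j, which depends only on i − j
modulo 3. -/
theorem trace_comm (b : EigenBasis X Y P M N h) : (mat (X * Y * X⁻¹ * Y⁻¹)).trace =
    (M 0 0 * N 0 0 + M 1 1 * N 1 1 + M 2 2 * N 2 2) +
      cubeRoot ^ 2 * (M 0 1 * N 1 0 + M 1 2 * N 2 1 + M 2 0 * N 0 2) +
      cubeRoot * (M 1 0 * N 0 1 + M 2 1 * N 1 2 + M 0 2 * N 2 0) := by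
  have h3 := pow_three_of_root cubeRoot_root
  have e : mat (X * Y * X⁻¹ * Y⁻¹) * P = P * (cubeDiag * M * (cubeDiagInv * N)) := by
    rw [mat_mul, mat_mul, mat_mul, mul_assoc, b.mul_Y_inv, mul_assoc, ← mul_assoc (mat X⁻¹),
      b.mul_X_inv, mul_assoc (mat X), mul_assoc P, ← mul_assoc (mat Y), b.mul_Y, mul_assoc P,
      ← mul_assoc (mat X), b.mul_X]
    simp only [mul_assoc]
  rw [trace_eq_of_mul_eq_mul b.det_ne_zero e, trace_fin_three, cubeDiag, cubeDiagInv]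
  simp only [mul_apply, Fin.sum_univ_three]
  simp
  linear_combination (M 1 1 * N 1 1 + M 2 2 * N 2 2 + cubeRoot * M 2 1 * N 1 2) * h3

/-- The real numbers `M i j * N j i`. -/
theorem mul_eq_real (b : EigenBasis X Y P M N h) (i j : Fin 3) :
    M i j * N j i = ((Complex.normSq (M i j) * h i / h j : ℝ) : ℂ) := by
  have hj : (h j : ℂ) ≠ 0 := by exact_mod_cast b.norm_ne_zero j
  have := b.adjoint j i
  push_cast
  rw [Complex.normSq_eq_conj_mul_self, eq_div_iff hj]
  linear_combination (-M i j) * this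

theorem inv_eq_adjugate (b : EigenBasis X Y P M N h) (hd : (mat Y).det = 1) :
    N = adjugate M := by
  have hM : M.det = 1 := by rw [← det_eq_of_mul_eq_mul b.det_ne_zero b.mul_Y, hd]
  calc N = adjugate M * M * N := by rw [adjugate_mul, hM, one_smul, one_mul]
    _ = _ := by rw [mul_assoc, b.mul_inv, mul_one]

end EigenBasis

end CRTriangle

namespace CRTriangle

/-! ### Consequences of unipotency for matrix entries and traces -/

open Matrix ComplexConjugate U21

theorem re_of_root {c : ℂ} (h : c ^ 2 + c + 1 = 0) : c.re = -1 / 2 := by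
  have := congrArg Complex.re (conj_of_root h)
  simp at this
  linarith

/-- Real numbers `T ≠ 0`, `s`, `s'` of sum `3` with `T + ω² s + ω s'` three times a cube root of
unity are `3`, `0`, `0`. -/
theorem trace_decomposition {T s s' : ℝ} {c : ℂ} (hc : c ^ 3 = 1) (hT : T ≠ 0)
    (hsum : T + s + s' = 3)
    (h : (T : ℂ) + cubeRoot ^ 2 * s + cubeRoot * s' = 3 * c) :
    T = 3 ∧ s = 0 ∧ s' = 0 ∧ c = 1 := by
  have hω : cubeRoot ^ 2 = -1 - cubeRoot := by linear_combination cubeRoot_root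
  rw [hω] at h
  -- Real parts together with the sum give T = 1 + 2 Re c, which is 3 for c = 1 and 0 for the other
  -- cube roots; imaginary parts then compare s and s'.
  have hre := congrArg Complex.re h
  have him := congrArg Complex.im h
  simp [cubeRoot] at hre him
  have hc' : (c - 1) * (c ^ 2 + c + 1) = 0 := by linear_combination hc
  rcases mul_eq_zero.1 hc' with h1 | h1
  · have hc1 : c = 1 := sub_eq_zero.1 h1
    rw [hc1] at hre him
    simp at hre him
    have h3 : √3 ≠ 0 := by positivity
    have hss : s = s' := by
      have : √3 * (s' - s) = 0 := by linarith
      have := (mul_eq_zero.1 this).resolve_left h3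
      linarith
    refine ⟨?_, ?_, ?_, hc1⟩ <;> linarith
  · exfalso
    have := re_of_root h1
    rw [this] at hre
    apply hT
    linarith

namespace EigenBasis

variable {X Y : U21} {P M N : Matrix (Fin 3) (Fin 3) ℂ} {h : Fin 3 → ℝ}

/-- The consequences of the unipotency of the commutator for the matrix entries of `Y`. -/
theorem entries (b : EigenBasis X Y P M N h) (hp : CommPair X Y) :
    M 0 0 + M 1 1 + M 2 2 = 0 ∧ N 0 0 + N 1 1 + N 2 2 = 0 ∧
    M 0 0 * N 0 0 + M 1 1 * N 1 1 + M 2 2 * N 2 2 = 3 ∧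
    M 0 0 * M 1 1 * M 2 2 - 1 = M 0 1 * M 1 2 * M 2 0 ∧
    M 0 1 * M 1 2 * M 2 0 = M 1 0 * M 2 1 * M 0 2 ∧
    (mat (X * Y)).det = 1 := by
  obtain ⟨P', hP', hYP⟩ := order_three_regular fun γ hγ => hp.regular hγ
  obtain ⟨htY, hdY⟩ := trace_and_det_of_regular hP' hYP
  have hdX := (trace_and_det_of_regular b.det_ne_zero b.mul_X).2
  have htY' : (mat Y⁻¹).trace = 0 := by rw [trace_mat_inv, htY, map_zero]
  have ht := htY
  have ht' := htY'
  rw [b.trace_Y] at ht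
  rw [b.trace_Y_inv] at ht'
  have hω := cubeRoot_root
  have h3 := pow_three_of_root hω
  set q : Fin 3 → Fin 3 → ℝ := fun i j => Complex.normSq (M i j) * h i / h j with hq
  have hMN : ∀ i j, M i j * N j i = (q i j : ℂ) := b.mul_eq_real
  have hrow : ∀ i, M i 0 * N 0 i + M i 1 * N 1 i + M i 2 * N 2 i = 1 := by
    intro i
    have := congrFun (congrFun b.mul_inv i) i
    rwa [mul_apply, Fin.sum_univ_three, one_apply_eq] at this
  obtain ⟨c, hc, hcomm⟩ := hp.trace_comm
  -- Parseval's identity on ℤ/3; the trivial character contributes nothing because tr Y = 0. As |tr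
  -- XY|² > 0, it excludes T = 0.
  have hT : 3 * (M 0 0 * N 0 0 + M 1 1 * N 1 1 + M 2 2 * N 2 2) =
      (Complex.normSq (mat (X * Y)).trace + Complex.normSq (mat (X * Y⁻¹)).trace : ℝ) := by
    push_cast
    rw [Complex.normSq_eq_conj_mul_self, Complex.normSq_eq_conj_mul_self, b.trace_X_inv_Y_inv,
      b.trace_X_inv_Y, b.trace_XY, b.trace_XY_inv]
    linear_combination (N 0 0 + N 1 1 + N 2 2) * ht - (N 0 0 * (M 1 1 + M 2 2) +
      M 0 0 * (N 1 1 + N 2 2)) * hω - (cubeRoot ^ 2 - cubeRoot + 1) * (M 1 1 * N 2 2 +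
        M 2 2 * N 1 1) * hω - 2 * (M 1 1 * N 1 1 + M 2 2 * N 2 2) * h3
  have hw : 0 < Complex.normSq (mat (X * Y)).trace := by
    rcases hp.normSq_trace with h | h <;> rw [h] <;> norm_num
  have key := trace_decomposition (T := q 0 0 + q 1 1 + q 2 2) (s := q 0 1 + q 1 2 + q 2 0)
    (s' := q 1 0 + q 2 1 + q 0 2) hc
    (by
      intro h0
      rw [hMN, hMN, hMN, ← Complex.ofReal_add, ← Complex.ofReal_add, h0] at hT
      have : Complex.normSq (mat (X * Y)).trace + Complex.normSq (mat (X * Y⁻¹)).trace = 0 := by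
        have h1 : ((Complex.normSq (mat (X * Y)).trace +
          Complex.normSq (mat (X * Y⁻¹)).trace : ℝ) : ℂ) = 0 := by rw [← hT]; simp
        exact_mod_cast h1
      have := Complex.normSq_nonneg (mat (X * Y⁻¹)).trace
      linarith)
    (by
      have h0 := hrow 0
      have h1 := hrow 1
      have h2 := hrow 2
      simp only [hMN] at h0 h1 h2
      have h0' : q 0 0 + q 0 1 + q 0 2 = 1 := by exact_mod_cast h0
      have h1' : q 1 0 + q 1 1 + q 1 2 = 1 := by exact_mod_cast h1
      have h2' : q 2 0 + q 2 1 + q 2 2 = 1 := by exact_mod_cast h2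
      linarith)
    (by
      rw [b.trace_comm] at hcomm
      simp only [hMN] at hcomm
      push_cast
      exact hcomm)
  obtain ⟨hT3, hs, hs', -⟩ := key
  have hT3' : M 0 0 * N 0 0 + M 1 1 * N 1 1 + M 2 2 * N 2 2 = 3 := by
    rw [hMN, hMN, hMN]; exact_mod_cast hT3
  have hs1 : M 0 1 * N 1 0 + M 1 2 * N 2 1 + M 2 0 * N 0 2 = 0 := by
    rw [hMN, hMN, hMN]; exact_mod_cast hs
  have hs2 : M 1 0 * N 0 1 + M 2 1 * N 1 2 + M 0 2 * N 2 0 = 0 := by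
    rw [hMN, hMN, hMN]; exact_mod_cast hs'
  have hN := b.inv_eq_adjugate hdY
  have hdM : M.det = 1 := by rw [← det_eq_of_mul_eq_mul b.det_ne_zero b.mul_Y, hdY]
  rw [det_fin_three] at hdM
  rw [hN, adjugate_fin_three] at hs1 hs2
  simp at hs1 hs2
  -- With N the adjugate of M, each of the two sums is three times a cyclic product minus the same
  -- symmetric expression ∑ M_ij M_ji M_kk. Subtracting gives this equality, and det M = 1 then
  -- gives the product of the diagonal entries.
  have he : M 0 1 * M 1 2 * M 2 0 = M 1 0 * M 2 1 * M 0 2 := by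
    linear_combination (hs1 - hs2) / 3
  refine ⟨ht, ht', hT3', ?_, he, ?_⟩
  · linear_combination hdM - hs1 + he
  · rw [mat_mul, det_mul, hdX, hdY, one_mul]

/-- The diagonals of M and N are recovered from w, z and their conjugates by Fourier inversion, so
the relations among entries become equations in the two traces alone. -/
theorem trace_identities (b : EigenBasis X Y P M N h) (hp : CommPair X Y) {w z : ℂ}
    (hw : w = (mat (X * Y)).trace) (hz : z = (mat (X * Y⁻¹)).trace) :
    w * conj w + z * conj z = 9 ∧
      w ^ 3 + conj w ^ 3 + z ^ 3 + conj z ^ 3 + (w * conj w) * (z * conj z) = 54 := by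
  obtain ⟨ht, ht', hT, hA, he, -⟩ := b.entries hp
  obtain ⟨P', hP', hYP⟩ := order_three_regular fun γ hγ => hp.regular hγ
  have hN := b.inv_eq_adjugate (trace_and_det_of_regular hP' hYP).2
  have hω := cubeRoot_root
  have h3 := pow_three_of_root hω
  have h1 : w = M 0 0 + cubeRoot * M 1 1 + cubeRoot ^ 2 * M 2 2 := by rw [hw, b.trace_XY]
  have h2 : conj w = N 0 0 + cubeRoot ^ 2 * N 1 1 + cubeRoot * N 2 2 := by
    rw [hw, b.trace_X_inv_Y_inv]
  have h4 : z = N 0 0 + cubeRoot * N 1 1 + cubeRoot ^ 2 * N 2 2 := by rw [hz, b.trace_XY_inv]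
  have h5 : conj z = M 0 0 + cubeRoot ^ 2 * M 1 1 + cubeRoot * M 2 2 := by
    rw [hz, b.trace_X_inv_Y]
  generalize conj w = w' at *
  generalize conj z = z' at *
  clear hw hz
  have n0 : N 0 0 = M 1 1 * M 2 2 - M 1 2 * M 2 1 := by rw [hN, adjugate_fin_three]; simp
  have n1 : N 1 1 = M 0 0 * M 2 2 - M 0 2 * M 2 0 := by rw [hN, adjugate_fin_three]; simp
  have n2 : N 2 2 = M 0 0 * M 1 1 - M 0 1 * M 1 0 := by rw [hN, adjugate_fin_three]; simp
  generalize M 0 0 = a₀ at *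
  generalize M 1 1 = a₁ at *
  generalize M 2 2 = a₂ at *
  generalize N 0 0 = c₀ at *
  generalize N 1 1 = c₁ at *
  generalize N 2 2 = c₂ at *
  generalize cubeRoot = ω at *
  have i0 : 3 * a₀ = w + z' := by linear_combination ht - h1 - h5 - (a₁ + a₂) * hω
  have i1 : 3 * a₁ = ω ^ 2 * w + ω * z' := by
    linear_combination ht - ω ^ 2 * h1 - ω * h5 - a₀ * hω - 2 * a₁ * h3 -
      a₂ * (ω ^ 2 - ω + 1) * hω
  have i2 : 3 * a₂ = ω * w + ω ^ 2 * z' := by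
    linear_combination ht - ω * h1 - ω ^ 2 * h5 - a₀ * hω - 2 * a₂ * h3 -
      a₁ * (ω ^ 2 - ω + 1) * hω
  have j0 : 3 * c₀ = z + w' := by linear_combination ht' - h4 - h2 - (c₁ + c₂) * hω
  have j1 : 3 * c₁ = ω ^ 2 * z + ω * w' := by
    linear_combination ht' - ω ^ 2 * h4 - ω * h2 - c₀ * hω - 2 * c₁ * h3 -
      c₂ * (ω ^ 2 - ω + 1) * hω
  have j2 : 3 * c₂ = ω * z + ω ^ 2 * w' := by
    linear_combination ht' - ω * h4 - ω ^ 2 * h2 - c₀ * hω - 2 * c₂ * h3 -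
      c₁ * (ω ^ 2 - ω + 1) * hω
  have hK : w * w' + z * z' = 9 := by
    have e : 9 * (a₀ * c₀ + a₁ * c₁ + a₂ * c₂) = 3 * (w * w' + z * z') := by
      calc 9 * (a₀ * c₀ + a₁ * c₁ + a₂ * c₂) =
          (3 * a₀) * (3 * c₀) + (3 * a₁) * (3 * c₁) + (3 * a₂) * (3 * c₂) := by ring
        _ = _ := by
          rw [i0, i1, i2, j0, j1, j2]
          linear_combination 2 * (w * w' + z * z') * h3 +
            (w * z + z' * w') * (ω ^ 2 - ω + 1) * hω
    rw [hT] at e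
    linear_combination -e / 3
  have hAw : 27 * (a₀ * a₁ * a₂) = w ^ 3 + z' ^ 3 := by
    calc 27 * (a₀ * a₁ * a₂) = (3 * a₀) * (3 * a₁) * (3 * a₂) := by ring
      _ = _ := by
        rw [i0, i1, i2]
        linear_combination (w ^ 3 + z' ^ 3) * h3 +
          (w ^ 2 * z' + w * z' ^ 2) * ((ω ^ 2 - ω + 1) * hω + h3)
  have b0 : 9 * (a₁ * a₂ - c₀) = (w ^ 2 - 3 * w') + (z' ^ 2 - 3 * z) - w * z' := by
    calc 9 * (a₁ * a₂ - c₀) = (3 * a₁) * (3 * a₂) - 3 * (3 * c₀) := by ring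
      _ = _ := by
        rw [i1, i2, j0]
        linear_combination (w ^ 2 + z' ^ 2) * h3 + w * z' * (ω ^ 2 - ω + 1) * hω
  have b1 : 9 * (a₀ * a₂ - c₁) = ω * (w ^ 2 - 3 * w') + ω ^ 2 * (z' ^ 2 - 3 * z) - w * z' := by
    calc 9 * (a₀ * a₂ - c₁) = (3 * a₀) * (3 * a₂) - 3 * (3 * c₁) := by ring
      _ = _ := by
        rw [i0, i2, j1]
        linear_combination w * z' * hω
  have b2 : 9 * (a₀ * a₁ - c₂) = ω ^ 2 * (w ^ 2 - 3 * w') + ω * (z' ^ 2 - 3 * z) - w * z' := by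
    calc 9 * (a₀ * a₁ - c₂) = (3 * a₀) * (3 * a₁) - 3 * (3 * c₂) := by ring
      _ = _ := by
        rw [i0, i1, j2]
        linear_combination w * z' * hω
  -- Each factor on the right is some M_ij M_ji, so their product is that of the two cyclic
  -- products, both equal to a₀a₁a₂ − 1.
  have hprod : (a₀ * a₁ * a₂ - 1) ^ 2 = (a₁ * a₂ - c₀) * (a₀ * a₂ - c₁) * (a₀ * a₁ - c₂) := by
    rw [n0, n1, n2]
    linear_combination (a₀ * a₁ * a₂ - 1 + M 0 1 * M 1 2 * M 2 0) * hA -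
      M 0 1 * M 1 2 * M 2 0 * (-he)
  have hfin : (w ^ 3 + z' ^ 3 - 27) ^ 2 = (w ^ 2 - 3 * w') ^ 3 + (z' ^ 2 - 3 * z) ^ 3 +
      (-(w * z')) ^ 3 - 3 * (w ^ 2 - 3 * w') * (z' ^ 2 - 3 * z) * (-(w * z')) := by
    calc (w ^ 3 + z' ^ 3 - 27) ^ 2 = 729 * (a₀ * a₁ * a₂ - 1) ^ 2 := by rw [← hAw]; ring
      _ = (9 * (a₁ * a₂ - c₀)) * (9 * (a₀ * a₂ - c₁)) * (9 * (a₀ * a₁ - c₂)) := by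
        rw [hprod]; ring
      _ = _ := by
        rw [b0, b1, b2]
        generalize w ^ 2 - 3 * w' = p
        generalize z' ^ 2 - 3 * z = q
        generalize w * z' = r
        -- This is the factorisation of p³ + q³ + (−r)³ − 3pq(−r) over the cube roots of unity.
        linear_combination (p + q - r) * ((ω - 1) * (p ^ 2 + q ^ 2) +
          p * q * (ω ^ 2 - ω + 1) - (p * r + q * r)) * hω
  refine ⟨hK, ?_⟩
  linear_combination hfin / 27 - (w ^ 3 + z' ^ 3) / 3 * (hK) + (w * w' + z * z' + 9) * hK

end EigenBasis

/-- A real trace r differs from z by a cube root of unity, so z³ = r³ and |z|² = r²; the two trace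
identities then become incompatible equations in the single real number r. -/
theorem CommPair.not_hasRealTrace {X Y : U21} (hp : CommPair X Y) :
    ¬ HasRealTrace (proj (X * Y⁻¹)) := by
  rintro ⟨B, hB, hdB, htB⟩
  obtain ⟨P, M, N, h, b⟩ := hp.exists_eigenBasis
  obtain ⟨c, hc⟩ := proj_eq_iff.1 hB
  have hdXY := (b.entries hp).2.2.2.2.2
  obtain ⟨P', hP', hYP⟩ := order_three_regular fun γ hγ => hp.regular hγ
  have hdY := (trace_and_det_of_regular hP' hYP).2
  have hdX := (trace_and_det_of_regular b.det_ne_zero b.mul_X).2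
  have hdYi : (mat Y⁻¹).det = 1 := by
    have := congrArg det (mat_mul_mat_inv Y)
    rwa [det_mul, hdY, one_mul, det_one] at this
  have hc3 : c ^ 3 = 1 := by
    rw [hc, det_smul, mat_mul, det_mul, hdX, hdYi, Fintype.card_fin] at hdB
    simpa using hdB
  obtain ⟨h9, h54⟩ := b.trace_identities hp rfl rfl
  set w := (mat (X * Y)).trace with hw
  set z := (mat (X * Y⁻¹)).trace with hz
  obtain ⟨r, hr⟩ : ∃ r : ℝ, (mat B).trace = r := ⟨_, (Complex.ext rfl (by simpa using htB))⟩
  have hrz : (r : ℂ) = c * z := by rw [← hr, hc, trace_smul, smul_eq_mul, hz]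
  have hcc : c * conj c = 1 := by
    rw [Complex.mul_conj, normSq_of_pow_three_eq_one hc3]; norm_num
  have hz3 : z ^ 3 = (r : ℂ) ^ 3 := by rw [hrz, mul_pow, hc3, one_mul]
  have hz3' : conj z ^ 3 = (r : ℂ) ^ 3 := by
    rw [← map_pow, hz3, map_pow, Complex.conj_ofReal]
  have hzz : z * conj z = (r : ℂ) ^ 2 := by
    have : (r : ℂ) * conj (r : ℂ) = z * conj z := by
      rw [hrz, map_mul]; linear_combination (z * conj z) * hcc
    rw [← this, Complex.conj_ofReal, sq]
  obtain ⟨d, hd⟩ := hp.pow_XY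
  have hw3 := (trace_pow_three_of_pow_four hdXY hd).resolve_left hp.not_scalar
  rw [← hw] at hw3
  have hww : w * conj w = (Complex.normSq w : ℂ) := Complex.mul_conj w
  rw [hzz, hww] at h9 h54
  rw [hz3, hz3', ← map_pow] at h54
  have h9' : Complex.normSq w + r ^ 2 = 9 := by exact_mod_cast h9
  have hn3 : Complex.normSq w ^ 3 = Complex.normSq (w ^ 3) := (map_pow _ _ _).symm
  have hn := hp.normSq_trace
  rw [← hw] at hn
  have hcases : (Complex.normSq w = 1 ∧ (w ^ 3 + conj (w ^ 3) = 2 ∨ w ^ 3 + conj (w ^ 3) = -2)) ∨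
      (Complex.normSq w = 5 ∧ w ^ 3 + conj (w ^ 3) = 22) := by
    rcases hw3 with h | h | h | h <;> rw [h] at hn3 ⊢ <;> rcases hn with h' | h' <;>
      rw [h'] at hn3 ⊢ <;> norm_num [Complex.normSq_apply] at hn3 <;>
      simp <;> norm_num
    · rw [map_ofNat, map_ofNat]; ring
    · rw [map_ofNat, map_ofNat]; ring
  -- Now r² = 9 − |w|² is 8, 8 or 4, which makes the second identity linear in r with solution 11/4,
  -- 3 or 3/2; none has the required square.
  rcases hcases with ⟨h1, h2 | h2⟩ | ⟨h1, h2⟩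
  · rw [h2, h1] at h54
    have e : 2 + r ^ 3 + r ^ 3 + 1 * r ^ 2 = 54 := by exact_mod_cast h54
    have hr2 : r ^ 2 = 8 := by rw [h1] at h9'; linarith
    have : r = 44 / 16 := by linear_combination e / 16 - (1 / 16 + r / 8) * hr2
    rw [this] at hr2; norm_num at hr2
  · rw [h2, h1] at h54
    have e : -2 + r ^ 3 + r ^ 3 + 1 * r ^ 2 = 54 := by exact_mod_cast h54
    have hr2 : r ^ 2 = 8 := by rw [h1] at h9'; linarith
    have : r = 3 := by linear_combination e / 16 - (1 / 16 + r / 8) * hr2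
    rw [this] at hr2; norm_num at hr2
  · rw [h2, h1] at h54
    have e : 22 + r ^ 3 + r ^ 3 + 5 * r ^ 2 = 54 := by exact_mod_cast h54
    have hr2 : r ^ 2 = 4 := by rw [h1] at h9'; linarith
    have : r = 3 / 2 := by linear_combination e / 8 - (5 / 8 + r / 4) * hr2
    rw [this] at hr2; norm_num at hr2

end CRTriangle

namespace CRTriangle

open Matrix ComplexConjugate U21

/-! ### Lagrangian decompositions -/

theorem exists_unit_mul_eq {a a' : ℂ} (h : Complex.normSq a = Complex.normSq a') :
    ∃ u : ℂ, u * conj u = 1 ∧ u * a = a' := by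
  by_cases ha : a = 0
  · refine ⟨1, by simp, ?_⟩
    rw [ha, map_zero] at h
    rw [ha, mul_zero, Complex.normSq_eq_zero.1 h.symm]
  · refine ⟨a' / a, ?_, div_mul_cancel₀ _ ha⟩
    rw [Complex.mul_conj, Complex.normSq_div, h, div_self, Complex.ofReal_one]
    rw [← h]
    exact fun h0 => ha (Complex.normSq_eq_zero.1 h0)

/-- A cyclic triple of unit complex numbers with product one realizing given quotients. -/
theorem exists_cyclic_units {a₁ a₂ a₃ b₁ b₂ b₃ : ℂ}
    (h₁ : Complex.normSq a₁ = Complex.normSq b₁) (h₂ : Complex.normSq a₂ = Complex.normSq b₂)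
    (h₃ : Complex.normSq a₃ = Complex.normSq b₃) (h : a₁ * a₂ * a₃ = b₁ * b₂ * b₃) :
    ∃ u v w : ℂ, u * conj u = 1 ∧ v * conj v = 1 ∧ w * conj w = 1 ∧ u * v * w = 1 ∧
      u * a₁ = b₁ ∧ v * a₂ = b₂ ∧ w * a₃ = b₃ := by
  obtain ⟨u, hu, e₁⟩ := exists_unit_mul_eq h₁
  obtain ⟨v, hv, e₂⟩ := exists_unit_mul_eq h₂
  obtain ⟨w, hw, e₃⟩ := exists_unit_mul_eq h₃
  have key : ∀ x y : ℂ, x * conj x = 1 → y * conj y = 1 →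
      conj (x * y) * conj (conj (x * y)) = 1 := by
    intro x y hx hy
    rw [Complex.conj_conj, map_mul]
    linear_combination (y * conj y) * hx + hy
  -- A vanishing entry leaves its phase free, and that phase is used to make the product one. If a₁
  -- and a₂ are nonzero, the third equation follows from equality of the products.
  by_cases z₁ : a₁ = 0
  · refine ⟨conj (v * w), v, w, key v w hv hw, hv, hw, ?_, ?_, e₂, e₃⟩
    · rw [map_mul]; linear_combination (w * conj w) * hv + hw
    · rw [← e₁, z₁]; simp
  by_cases z₂ : a₂ = 0
  · refine ⟨u, conj (u * w), w, hu, key u w hu hw, hw, ?_, e₁, ?_, e₃⟩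
    · rw [map_mul]; linear_combination (w * conj w) * hu + hw
    · rw [← e₂, z₂]; simp
  · refine ⟨u, v, conj (u * v), hu, hv, key u v hu hv, ?_, e₁, e₂, ?_⟩
    · rw [map_mul]; linear_combination (v * conj v) * hu + hv
    · rw [← e₁, ← e₂] at h
      have : a₃ = u * v * b₃ :=
        mul_left_cancel₀ (mul_ne_zero z₁ z₂) (by linear_combination h)
      rw [this, map_mul]
      linear_combination b₃ * ((v * conj v) * hu + hv)

namespace EigenBasis

variable {X Y : U21} {P M N : Matrix (Fin 3) (Fin 3) ℂ} {h : Fin 3 → ℝ}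

/-- By the adjoint relation, the condition on d says that its phase quotients carry h_i M_ij to h_j
M_ji. The moduli match, and equality of the cyclic products is what makes the quotients consistent
around the triangle. -/
theorem exists_phases (b : EigenBasis X Y P M N h) (hp : CommPair X Y) :
    ∃ d : Fin 3 → ℂ, (∀ i, d i * conj (d i) = 1) ∧
      ∀ i j, d i * conj (M i j) * conj (d j) = N i j := by
  obtain ⟨-, -, -, -, he, -⟩ := b.entries hp
  have hh : ∀ i, (h i : ℂ) ≠ 0 := fun i => by exact_mod_cast b.norm_ne_zero i
  obtain ⟨P', hP', hYP⟩ := order_three_regular fun γ hγ => hp.regular hγ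
  have hN := b.inv_eq_adjugate (trace_and_det_of_regular hP' hYP).2
  rw [adjugate_fin_three] at hN
  have s01 : M 0 1 * N 1 0 = M 1 0 * N 0 1 := by
    rw [hN]; simp; linear_combination he
  have s12 : M 1 2 * N 2 1 = M 2 1 * N 1 2 := by
    rw [hN]; simp; linear_combination he
  have s20 : M 2 0 * N 0 2 = M 0 2 * N 2 0 := by
    rw [hN]; simp; linear_combination he
  have hnorm : ∀ i j, M i j * N j i = M j i * N i j →
      Complex.normSq (h i * M i j) = Complex.normSq (h j * M j i) := by
    intro i j hij
    rw [b.mul_eq_real, b.mul_eq_real] at hij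
    have hij : Complex.normSq (M i j) * h i / h j = Complex.normSq (M j i) * h j / h i := by
      exact_mod_cast hij
    rw [div_eq_div_iff (b.norm_ne_zero j) (b.norm_ne_zero i)] at hij
    rw [map_mul, map_mul, Complex.normSq_ofReal, Complex.normSq_ofReal]
    linear_combination hij
  obtain ⟨u, v, w, hu, hv, hw, huvw, e₁, e₂, e₃⟩ := exists_cyclic_units (hnorm 0 1 s01)
    (hnorm 1 2 s12) (hnorm 2 0 s20) (by linear_combination (h 0 * h 1 * h 2 : ℂ) * he)
  have hwuv : conj w = u * v := by linear_combination (u * v) * hw - conj w * huvw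
  have key : ∀ i j (x y : ℂ), y * conj x * (h i * M i j) = h j * M j i →
      x * conj (M i j) * conj y = N i j := by
    intro i j x y hxy
    apply mul_left_cancel₀ (hh i)
    rw [← b.adjoint i j]
    have := congrArg conj hxy
    simp only [map_mul, Complex.conj_ofReal, Complex.conj_conj] at this
    linear_combination this
  have key' : ∀ i j (x y : ℂ), x * conj x = 1 → y * conj y = 1 →
      y * conj x * (h i * M i j) = h j * M j i → x * conj y * (h j * M j i) = h i * M i j := by
    intro i j x y hx hy hxy
    rw [← hxy]
    linear_combination (h i * M i j * y * conj y) * hx + (h i * M i j) * hy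
  have diag : ∀ i (x : ℂ), x * conj x = 1 → x * conj (M i i) * conj x = N i i := by
    intro i x hx
    apply mul_left_cancel₀ (hh i)
    rw [← b.adjoint i i]
    linear_combination (h i * conj (M i i)) * hx
  have hone : (1 : ℂ) * conj 1 = 1 := by simp
  have huv : (u * v) * conj (u * v) = 1 := by
    rw [map_mul]; linear_combination (v * conj v) * hu + hv
  have f01 : u * conj 1 * (h 0 * M 0 1) = h 1 * M 1 0 := by
    rw [map_one, mul_one, e₁]
  have f12 : (u * v) * conj u * (h 1 * M 1 2) = h 2 * M 2 1 := by
    linear_combination e₂ + (v * h 1 * M 1 2) * hu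
  have f20 : 1 * conj (u * v) * (h 2 * M 2 0) = h 0 * M 0 2 := by
    rw [← hwuv, Complex.conj_conj, one_mul, e₃]
  -- Only quotients matter, so d₀ = 1; uvw = 1 makes the step from 2 back to 0 have phase w.
  refine ⟨![1, u, u * v], ?_, ?_⟩
  · intro i
    fin_cases i
    · exact hone
    · exact hu
    · exact huv
  · intro i j
    fin_cases i <;> fin_cases j
    · exact diag 0 1 hone
    · exact key 0 1 1 u f01
    · exact key 0 2 1 (u * v) (key' 2 0 (u * v) 1 huv hone f20)
    · exact key 1 0 u 1 (key' 0 1 1 u hone hu f01)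
    · exact diag 1 u hu
    · exact key 1 2 u (u * v) f12
    · exact key 2 0 (u * v) 1 f20
    · exact key 2 1 (u * v) u (key' 1 2 u (u * v) hu huv f12)
    · exact diag 2 (u * v) huv

end EigenBasis

/-- The antilinear map `v ↦ S v̄`. -/
def antilinear (S : Matrix (Fin 3) (Fin 3) ℂ) : (Fin 3 → ℂ) →ₗ⋆[ℂ] (Fin 3 → ℂ) where
  toFun v := S *ᵥ star v
  map_add' v w := by rw [star_add, mulVec_add]
  map_smul' c v := by rw [star_smul, mulVec_smul]; rfl

theorem antilinear_apply (S : Matrix (Fin 3) (Fin 3) ℂ) (v : Fin 3 → ℂ) :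
    antilinear S v = S *ᵥ star v := rfl

theorem star_mulVec_map (A : Matrix (Fin 3) (Fin 3) ℂ) (v : Fin 3 → ℂ) :
    star (A *ᵥ v) = A.map conj *ᵥ star v := by
  ext i
  simp [mulVec, dotProduct]

theorem antilinear_comp (S T : Matrix (Fin 3) (Fin 3) ℂ) (v : Fin 3 → ℂ) :
    antilinear S (antilinear T v) = (S * T.map conj) *ᵥ v := by
  rw [antilinear_apply, antilinear_apply, star_mulVec_map, star_star, mulVec_mulVec]

theorem isAntiReflection_antilinear {S : Matrix (Fin 3) (Fin 3) ℂ} (h₁ : S * S.map conj = 1)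
    (h₂ : Sᴴ * U21.gram * S = U21.gram) : IsAntiReflection (antilinear S) := by
  refine ⟨fun v => by rw [antilinear_comp, h₁, one_mulVec], fun v w => ?_⟩
  rw [antilinear_apply, antilinear_apply, herm_mulVec, h₂, ← herm_eq_dotProduct]
  simp [herm]

/-- In the eigenbasis the involution is v ↦ Δv̄. It inverts X because the eigenvalues have modulus
one, and Y by the choice of phases. -/
theorem isLagrangianTriangle_of_commPair {p q r : ℕ} {η : TriangleGroup₂ p q r →* PU21}
    {X Y : U21} (hX : proj X = η (genX p q r)) (hY : proj Y = η (genY p q r))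
    (hp : CommPair X Y) : IsLagrangianTriangle η := by
  obtain ⟨P, M, N, h, b⟩ := hp.exists_eigenBasis
  obtain ⟨d, hd, hdMN⟩ := b.exists_phases hp
  have hu := isUnit_iff_ne_zero.2 b.det_ne_zero
  set Q := P.map conj with hQ
  have hQu : IsUnit Q.det := by
    rw [hQ, show P.map conj = (conj : ℂ →+* ℂ).mapMatrix P from rfl, ← RingHom.map_det]
    exact hu.map _
  set Δ : Matrix (Fin 3) (Fin 3) ℂ := diagonal d
  have hmul : ∀ A B : Matrix (Fin 3) (Fin 3) ℂ, (A * B).map conj = A.map conj * B.map conj :=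
    fun A B => Matrix.map_mul
  have hmm : ∀ A : Matrix (Fin 3) (Fin 3) ℂ, (A.map conj).map conj = A := by
    intro A; ext i j; simp
  set S := P * Δ * Q⁻¹ with hS
  have hSQ : S * Q = P * Δ := by rw [hS, nonsing_inv_mul_cancel_right _ _ hQu]
  have hΔ : Δ * Δ.map conj = 1 := by
    ext i j
    simp only [Δ, diagonal_map (map_zero conj), diagonal_mul_diagonal, hd]
    simp
  have hcancel : ∀ A B : Matrix (Fin 3) (Fin 3) ℂ, A * P = B * P → A = B := by
    intro A B hAB
    have := congrArg (· * P⁻¹) hAB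
    simpa only [mul_nonsing_inv_cancel_right _ _ hu] using this
  have hSP : S.map conj * P = Q * Δ.map conj := by
    have := congrArg (fun A => A.map conj) hSQ
    simpa only [hmul, hQ, hmm] using this
  have hSS : S * S.map conj = 1 := by
    apply hcancel
    rw [mul_assoc, hSP, ← mul_assoc, hSQ, mul_assoc, hΔ, mul_one, one_mul]
  have hSXS : S * (mat X).map conj * S.map conj = mat X⁻¹ := by
    apply hcancel
    have hXQ : (mat X).map conj * Q = Q * cubeDiagInv := by
      have := congrArg (fun A => A.map conj) b.mul_X
      simp only [hmul] at this
      rw [hQ, this, ← conjTranspose_cubeDiag, cubeDiag, diagonal_conjTranspose,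
        diagonal_map (map_zero conj)]
      rfl
    rw [mul_assoc, hSP, mul_assoc, ← mul_assoc _ Q, hXQ, mul_assoc Q, ← mul_assoc S, hSQ,
      b.mul_X_inv, mul_assoc]
    congr 1
    have : cubeDiagInv * Δ.map conj = Δ.map conj * cubeDiagInv := by
      simp only [Δ, cubeDiagInv, diagonal_map (map_zero conj), diagonal_mul_diagonal]
      congr 1; ext i; exact mul_comm _ _
    rw [this, ← mul_assoc, hΔ, one_mul]
  have hSYS : S * (mat Y).map conj * S.map conj = mat Y⁻¹ := by
    apply hcancel
    have hYQ : (mat Y).map conj * Q = Q * M.map conj := by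
      have := congrArg (fun A => A.map conj) b.mul_Y
      simpa only [hmul] using this
    rw [mul_assoc, hSP, mul_assoc, ← mul_assoc _ Q, hYQ, mul_assoc Q, ← mul_assoc S, hSQ,
      b.mul_Y_inv, mul_assoc]
    congr 1
    ext i j
    rw [← hdMN i j, diagonal_map (map_zero conj), diagonal_mul, mul_diagonal, map_apply,
      mul_assoc]
  -- The squared norms are real, so P and its conjugate Q have the same diagonal Gram matrix, which
  -- the unitary diagonal Δ preserves.
  have hSJ : Sᴴ * U21.gram * S = U21.gram := by
    have hg := b.gram_eq
    have hgQ : Qᴴ * U21.gram * Q = diagonal fun i => (h i : ℂ) := by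
      have := congrArg (fun A => A.map conj) hg
      simp only [hmul] at this
      have e1 : Pᴴ.map conj = Qᴴ := by ext i j; simp [hQ]
      have e2 : U21.gram.map conj = U21.gram := by
        ext i j; fin_cases i <;> fin_cases j <;> simp [U21.gram]
      rw [e1, e2, ← hQ] at this
      rw [this]
      ext i j
      by_cases hij : i = j
      · subst hij; simp
      · simp [hij]
    have e : (S * Q)ᴴ * U21.gram * (S * Q) = Qᴴ * U21.gram * Q := by
      rw [hSQ, hgQ, conjTranspose_mul]
      calc Δᴴ * Pᴴ * U21.gram * (P * Δ) = Δᴴ * (Pᴴ * U21.gram * P) * Δ := by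
            simp only [mul_assoc]
        _ = _ := by
            rw [hg, diagonal_conjTranspose, diagonal_mul_diagonal, diagonal_mul_diagonal]
            congr 1
            ext i
            change conj (d i) * h i * d i = h i
            linear_combination (h i : ℂ) * hd i
    have hQu' : IsUnit Qᴴ.det := by
      rw [det_conjTranspose]; exact hQu.star
    have e' : Qᴴ * (Sᴴ * U21.gram * S) * Q = Qᴴ * U21.gram * Q := by
      rw [← e, conjTranspose_mul S]; simp only [mul_assoc]
    have := congrArg (fun A => Qᴴ⁻¹ * (A * Q⁻¹)) e'
    simpa only [mul_nonsing_inv_cancel_right _ _ hQu, nonsing_inv_mul_cancel_left _ _ hQu'] using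
      this
  have hgram_map : U21.gram.map conj = U21.gram := by
    ext i j; fin_cases i <;> fin_cases j <;> simp [U21.gram]
  have hYconj : ((mat Y).map conj)ᴴ * U21.gram * (mat Y).map conj = U21.gram := by
    have := congrArg (fun A => A.map conj) (conjTranspose_mul_gram_mul Y)
    simp only [hmul, hgram_map] at this
    have e1 : (mat Y)ᴴ.map conj = ((mat Y).map conj)ᴴ := by ext i j; simp
    rwa [e1] at this
  -- These are Xσ₂, σ₂ and σ₂Y. The outer two are involutions because σ₂Xσ₂ = X⁻¹ and σ₂Yσ₂ = Y⁻¹.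
  refine ⟨antilinear (mat X * S), antilinear S, antilinear (S * (mat Y).map conj), ?_, ?_, ?_,
    ⟨X, hX, fun v => ?_⟩, ⟨Y, hY, fun v => ?_⟩⟩
  · apply isAntiReflection_antilinear
    · rw [hmul, mul_assoc, ← mul_assoc S, hSXS, mat_mul_mat_inv]
    · rw [conjTranspose_mul]
      calc Sᴴ * (mat X)ᴴ * U21.gram * (mat X * S) =
            Sᴴ * ((mat X)ᴴ * U21.gram * mat X) * S := by simp only [mul_assoc]
        _ = _ := by rw [conjTranspose_mul_gram_mul, hSJ]
  · exact isAntiReflection_antilinear hSS hSJ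
  · apply isAntiReflection_antilinear
    · rw [hmul, hmm, ← mul_assoc, hSYS, mat_inv_mul_mat]
    · rw [conjTranspose_mul]
      calc ((mat Y).map conj)ᴴ * Sᴴ * U21.gram * (S * (mat Y).map conj) =
            ((mat Y).map conj)ᴴ * (Sᴴ * U21.gram * S) * (mat Y).map conj := by
              simp only [mul_assoc]
        _ = _ := by rw [hSJ, hYconj]
  · rw [antilinear_comp, mul_assoc, hSS, mul_one]
  · rw [antilinear_comp, hmul, hmm, ← mul_assoc, hSS, one_mul]

end CRTriangle

namespace CRTriangle

open Matrix ComplexConjugate U21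

/-! ### Lifts of representations -/

/-- The characteristic polynomial of A − 1 is X³; its value at −1 is det(−A). -/
theorem det_eq_one_of_isNilpotent_sub_one {A : Matrix (Fin 3) (Fin 3) ℂ}
    (h : IsNilpotent (A - 1)) : A.det = 1 := by
  have h1 := (isNilpotent_charpoly_sub_pow_of_isNilpotent h).eq_zero
  have h2 := congrArg (Polynomial.eval (-1)) h1
  rw [Polynomial.eval_sub, eval_charpoly, Polynomial.eval_pow, Polynomial.eval_X,
    Polynomial.eval_zero, Fintype.card_fin, scalar_apply, ← smul_one_eq_diagonal] at h2
  have e : (-1 : ℂ) • (1 : Matrix (Fin 3) (Fin 3) ℂ) - (A - 1) = -A := by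
    rw [neg_one_smul]; abel
  rw [e, det_neg, Fintype.card_fin] at h2
  linear_combination -h2

theorem trace_eq_three_of_isNilpotent_sub_one {A : Matrix (Fin 3) (Fin 3) ℂ}
    (h : IsNilpotent (A - 1)) : A.trace = 3 := by
  have h1 := (isNilpotent_trace_of_isNilpotent h).eq_zero
  rw [trace_sub, trace_one, Fintype.card_fin] at h1
  push_cast at h1
  linear_combination h1

/-- The commutator of the lifts and the unipotent lift both have determinant one, so they differ by
a cube root of unity; this is the c in the trace condition. -/
theorem exists_commPair {η : TriangleGroup₂ 3 3 4 →* PU21}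
    (h : IsUnipotent (η (genComm 3 3 4))) :
    ∃ X Y : U21, proj X = η (genX 3 3 4) ∧ proj Y = η (genY 3 3 4) ∧ CommPair X Y := by
  obtain ⟨r₁, r₂, r₃⟩ := triangle₂_rels η
  obtain ⟨X, hX, hX3⟩ := exists_lift_pow_eq_one (by norm_num) r₁
  obtain ⟨Y, hY, hY3⟩ := exists_lift_pow_eq_one (by norm_num) r₂
  have hcomm : η (genComm 3 3 4) = proj (X * Y * X⁻¹ * Y⁻¹) := by
    simp only [genComm, map_mul, map_inv, hX, hY]
  obtain ⟨hne, A, hA, hnil⟩ := h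
  rw [hcomm] at hne hA
  refine ⟨X, Y, hX, hY, hX3, hY3, ?_, ?_, ?_⟩
  · rw [← hX, ← hY, ← map_mul, ← map_pow, proj_eq_one_iff, mat_pow] at r₃
    exact r₃
  · obtain ⟨c, hc⟩ := proj_eq_iff.1 hA
    have hd := det_eq_one_of_isNilpotent_sub_one hnil
    have ht := trace_eq_three_of_isNilpotent_sub_one hnil
    have hdC : (mat (X * Y * X⁻¹ * Y⁻¹)).det = 1 := by
      have h1 := congrArg det (mat_mul_mat_inv X)
      have h2 := congrArg det (mat_mul_mat_inv Y)
      rw [det_mul, det_one] at h1 h2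
      rw [mat_mul, mat_mul, mat_mul, det_mul, det_mul, det_mul]
      linear_combination h1 * ((mat Y).det * (mat Y⁻¹).det) + h2
    rw [hc, det_smul, hdC, Fintype.card_fin, mul_one] at hd
    rw [hc, trace_smul, smul_eq_mul] at ht
    have hc0 : c ≠ 0 := by rintro rfl; simp at hd
    refine ⟨c⁻¹, by rw [inv_pow, hd, inv_one], ?_⟩
    rw [← ht]
    field_simp
  · intro h
    apply hne
    have e : X * Y * X⁻¹ * Y⁻¹ = 1 := by rw [h]; group
    rw [e, map_one]

/-! ### Existence -/

/-- The number `(1 - i√7) / 4`. -/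
noncomputable def beta : ℂ := ⟨1 / 4, -√7 / 4⟩

theorem beta_root : 2 * beta ^ 2 - beta + 1 = 0 := by
  have := Real.mul_self_sqrt (show (0 : ℝ) ≤ 7 by norm_num)
  apply Complex.ext
  · simp [beta, pow_two]; linarith
  · simp [beta, pow_two]; ring

theorem conj_beta : conj beta = 1 / 2 - beta := by
  apply Complex.ext
  · simp [beta]; norm_num
  · simp [beta]

/-- The matrix of the image of `x`. -/
noncomputable def matX : Matrix (Fin 3) (Fin 3) ℂ :=
  !![1, -1, 1; beta, beta, 0; -(1 + beta) / 2, (1 + beta) / 2, -1 - beta]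

/-- The matrix of the image of `y`. -/
noncomputable def matY : Matrix (Fin 3) (Fin 3) ℂ :=
  !![beta, 1 - beta, beta - 1 / 2; beta, beta - 1, 1 / 2 - beta; 0, beta - 1, 1 - 2 * beta]

/-- The matrix of the image of `[x,y]`. -/
noncomputable def matComm : Matrix (Fin 3) (Fin 3) ℂ :=
  !![0, 2 * beta, -1 / 2 - beta; 2 * beta - 1, 1, beta - 3 / 2; 1 - beta, -1 - beta, 2]

theorem gram_eq_of : U21.gram = !![1, 0, 0; 0, 1, 0; 0, 0, -1] := by
  ext i j; fin_cases i <;> fin_cases j <;> simp [U21.gram]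

theorem matX_unitary : matXᴴ * U21.gram * matX = U21.gram := by
  have h := beta_root
  have hc := conj_beta
  have h2 : conj (2 : ℂ) = 2 := map_ofNat _ 2
  rw [gram_eq_of, matX]
  ext i j
  fin_cases i <;> fin_cases j <;>
    simp [mul_apply, Fin.sum_univ_three, hc, h2] <;> grind

theorem matY_unitary : matYᴴ * U21.gram * matY = U21.gram := by
  have h := beta_root
  have hc := conj_beta
  have h2 : conj (2 : ℂ) = 2 := map_ofNat _ 2
  rw [gram_eq_of, matY]
  ext i j
  fin_cases i <;> fin_cases j <;>
    simp [mul_apply, Fin.sum_univ_three, hc, h2] <;> grind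

/-- The lift is not normalised: a scalar cube suffices in PU(2,1). -/
theorem matX_pow : matX ^ 3 = ((1 - 3 * beta) / 2) • (1 : Matrix (Fin 3) (Fin 3) ℂ) := by
  have h := beta_root
  rw [matX, pow_succ, pow_two]
  ext i j
  fin_cases i <;> fin_cases j <;>
    simp [mul_apply, Fin.sum_univ_three] <;> grind

theorem matY_pow : matY ^ 3 = (beta - 1) • (1 : Matrix (Fin 3) (Fin 3) ℂ) := by
  have h := beta_root
  rw [matY, pow_succ, pow_two]
  ext i j
  fin_cases i <;> fin_cases j <;>
    simp [mul_apply, Fin.sum_univ_three] <;> grind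

/-- Up to a scalar this is a quarter turn of a plane together with −1 on the third axis, which makes
the order four visible. -/
theorem matX_mul_matY : matX * matY =
    !![0, 1 - beta, 0; beta - 1, 0, 0; 0, 0, beta - 1] := by
  have h := beta_root
  rw [matX, matY]
  ext i j
  fin_cases i <;> fin_cases j <;>
    simp [mul_apply, Fin.sum_univ_three] <;> grind

theorem matX_mul_matY_pow :
    (matX * matY) ^ 4 = ((beta - 1) ^ 4) • (1 : Matrix (Fin 3) (Fin 3) ℂ) := by
  rw [matX_mul_matY, show (4 : ℕ) = 2 * 2 from rfl, pow_mul, pow_two]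
  ext i j
  fin_cases i <;> fin_cases j <;>
    simp [mul_apply, Fin.sum_univ_three, pow_two] <;> ring

/-- Writing [X,Y] = XY(YX)⁻¹ in this form avoids computing inverses. -/
theorem matComm_mul : matComm * (matY * matX) = matX * matY := by
  have h := beta_root
  rw [matX_mul_matY, matX, matY, matComm]
  ext i j
  fin_cases i <;> fin_cases j <;>
    simp [mul_apply, Fin.sum_univ_three] <;> grind

theorem matComm_sub_one_sq : (matComm - 1) * (matComm - 1) =
    !![-2, 0, -1 - 2 * beta; 0, 0, 0; 2 - 2 * beta, 0, 2] := by
  have h := beta_root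
  rw [matComm]
  ext i j
  fin_cases i <;> fin_cases j <;>
    simp [mul_apply, Fin.sum_univ_three] <;> grind

theorem isNilpotent_matComm : IsNilpotent (matComm - 1) := by
  refine ⟨3, ?_⟩
  have h := beta_root
  rw [pow_succ, pow_two, matComm_sub_one_sq, matComm]
  ext i j
  fin_cases i <;> fin_cases j <;>
    simp [mul_apply, Fin.sum_univ_three] <;> grind

/-- A representation of the triangle group sending the commutator to a unipotent element. -/
theorem exists_isUnipotent :
    ∃ η : TriangleGroup₂ 3 3 4 →* PU21, IsUnipotent (η (genComm 3 3 4)) := by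
  set X := ofMatrix matX matX_unitary
  set Y := ofMatrix matY matY_unitary
  have hXY : mat (X * Y) = matX * matY := rfl
  have hYX : mat (Y * X) = matY * matX := rfl
  have hrel : ∀ w ∈ triangleRels₂ 3 3 4, FreeGroup.lift ![proj X, proj Y] w = 1 := by
    rintro w (rfl | rfl | rfl)
    · simp only [map_pow, FreeGroup.lift_apply_of, cons_val_zero]
      rw [← map_pow, proj_eq_one_iff, mat_pow]
      exact ⟨_, matX_pow⟩
    · simp only [map_pow, FreeGroup.lift_apply_of, cons_val_one]
      change (proj Y) ^ 3 = 1
      rw [← map_pow, proj_eq_one_iff, mat_pow]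
      exact ⟨_, matY_pow⟩
    · simp only [map_pow, map_mul, FreeGroup.lift_apply_of, cons_val_zero, cons_val_one]
      rw [← map_mul, ← map_pow, proj_eq_one_iff, mat_pow]
      exact ⟨_, matX_mul_matY_pow⟩
  have hcomm : mat (X * Y * X⁻¹ * Y⁻¹) = matComm := by
    have e : X * Y * X⁻¹ * Y⁻¹ = X * Y * (Y * X)⁻¹ := by group
    rw [e, mat_mul, hXY, ← matComm_mul, ← hYX, mul_assoc, mat_mul_mat_inv, mul_one]
  let η : TriangleGroup₂ 3 3 4 →* PU21 := PresentedGroup.toGroup hrel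
  have hx : η (genX 3 3 4) = proj X := PresentedGroup.toGroup.of hrel
  have hy : η (genY 3 3 4) = proj Y := PresentedGroup.toGroup.of hrel
  have hη : η (genComm 3 3 4) = proj (X * Y * X⁻¹ * Y⁻¹) := by
    simp only [genComm, map_mul, map_inv, hx, hy]
  refine ⟨η, ?_, X * Y * X⁻¹ * Y⁻¹, hη.symm, by rw [hcomm]; exact isNilpotent_matComm⟩
  rw [hη, Ne, proj_eq_one_iff, hcomm]
  rintro ⟨c, hc⟩
  -- A scalar matrix has equal diagonal entries, whereas the first two here are 0 and 1.
  have h1 := congrFun (congrFun hc 0) 0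
  have h2 := congrFun (congrFun hc 1) 1
  simp [matComm] at h1 h2
  rw [← h1] at h2
  exact one_ne_zero h2

end CRTriangle

/-! ### The main theorem -/

open CRTriangle
theorem mainTheorem2 :
    ∃ ρ : M023 →* TriangleGroup₂ 3 3 4,
      Function.Surjective ρ ∧
      -- `ρ` factors through the filling `m023(2,-1)`, presented with generators `a`, `b`
      (∃ (e : M023Filling 2 (-1) ≃* FillingPresentation)
          (ψ : FillingPresentation →* TriangleGroup₂ 3 3 4),
        (∃ g : FillingPresentation,
          e (QuotientGroup.mk meridian) = g * fillingCurve * g⁻¹ ∧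
          e (QuotientGroup.mk longitude) = g * (fillingCurve * fillingCurve) * g⁻¹) ∧
        ψ (PresentedGroup.of 0) = genX 3 3 4 * genY 3 3 4 ∧
        ψ (PresentedGroup.of 1) = genX 3 3 4 ∧
        ∀ h : M023, ρ h = ψ (e (QuotientGroup.mk h))) ∧
      -- representations sending `[x,y]` to a unipotent element exist
      (∃ η : TriangleGroup₂ 3 3 4 →* PU21, IsUnipotent (η (genComm 3 3 4))) ∧
      -- properties of all these representations
      (∀ η : TriangleGroup₂ 3 3 4 →* PU21, IsUnipotent (η (genComm 3 3 4)) →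
        IsBoundaryUnipotent (η.comp ρ) ∧
        ¬ HasRealTrace (η (genX 3 3 4 * (genY 3 3 4)⁻¹)) ∧
        (∀ (θ : ℝ) (γ : TriangleGroup 3 3 4 →* PU21), IsComplexTriangle θ γ →
          η.comp ρ ≠ (γ.comp (incl 3 3 4)).comp ρ) ∧
        IsLagrangianTriangle η) ∧
      -- the trace is real for complex hyperbolic triangle groups
      (∀ (θ : ℝ) (γ : TriangleGroup 3 3 4 →* PU21), IsComplexTriangle θ γ →
        HasRealTrace ((γ.comp (incl 3 3 4)) (genX 3 3 4 * (genY 3 3 4)⁻¹))) := by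
  refine ⟨m023ToTriangle, m023ToTriangle_surjective,
    ⟨fillingEquiv, presentationToTriangle, ⟨1, ?_, ?_⟩, presentationToTriangle_zero,
      presentationToTriangle_one, fun _ => rfl⟩,
    exists_isUnipotent, fun η hη => ?_, fun θ γ h => hasRealTrace_of_isComplexTriangle h⟩
  · rw [fillingEquiv_mk, m023ToPresentation_meridian, one_mul, inv_one, mul_one]
  · rw [fillingEquiv_mk, m023ToPresentation_longitude, one_mul, inv_one, mul_one]
  · obtain ⟨X, Y, hX, hY, hp⟩ := exists_commPair hη
    have htr : ¬ HasRealTrace (η (genX 3 3 4 * (genY 3 3 4)⁻¹)) := by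
      rw [map_mul, map_inv, ← hX, ← hY, ← map_inv, ← map_mul]
      exact hp.not_hasRealTrace
    refine ⟨isBoundaryUnipotent_comp hη, htr, fun θ γ hγ he => htr ?_,
      isLagrangianTriangle_of_commPair hX hY hp⟩
    -- Surjectivity of ρ cancels it, so the real trace of triangle groups would pass to η.
    have : η = γ.comp (incl 3 3 4) :=
      (MonoidHom.cancel_right m023ToTriangle_surjective).1 he
    rw [this]
    exact hasRealTrace_of_isComplexTriangle hγ
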